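/- For $q\ge 1$, $A,n>0$ put $I_{A,n}=[-3n/A,3n/A]$, and for a finite nonempty set $\mathcal C\subset I_{A,n}^q$ let $$\delta_{A,n}(\mathcal C)=\max_{\mathbf x\in I_{A,n}^q}\ \min_{\mathbf y\in\mathcal C}|\mathbf x-\mathbf y|_\infty ,$$ where $|\cdot|_\infty$ is the maximum norm on $\mathbb R^q$; $|\cdot|$ denotes the Euclidean norm. For $\lambda>0$ let $\mathbb P_\lambda^q$ (respectively $\mathbb P_\lambda^{q,\square}$) be the class of real polynomials in $q$ variables of total degree (respectively, of degree in each variable) $<\lambda^2$. Theorem. For every integer $q\ge 1$ there are constants $\beta,N,c>0$ depending only on $q$ such that the following holds. Let $A>0$, let $n\ge N$ be real, and let $\mathcal C\subset I_{A,n}^q$ be a finite nonempty set with $\delta_{A,n}(\mathcal C)\le \beta/(nA)$. Then there are real weights $\{w_{\mathbf y}\}_{\mathbf y\in\mathcal C}$ such that for all $P\in\mathbb P_{\sqrt2 n}^{q,\square}$ (that is, of degree $<2n^2$ in each variable), in particular for all products of two polynomials in $\mathbb P_n^q$, $$\sum_{\mathbf y\in\mathcal C}w_{\mathbf y}P(\mathbf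 y)\exp(-A^2|\mathbf y|^2)=\int_{\mathbb R^q}P(\mathbf y)\exp(-A^2|\mathbf y|^2)\,d\mathbf y,$$ moreover $$\max_{\mathbf y\in\mathcal C}|w_{\mathbf y}|\le c\,\delta_{A,n}(\mathcal C)^q,\qquad \sum_{\mathbf y\in\mathcal C}|w_{\mathbf y}|\le c\,A^{-q}n^q,$$ and, for all $P\in\mathbb P_{\sqrt2 n}^{q,\square}$, $$\sum_{\mathbf y\in\mathcal C}|w_{\mathbf y}P(\mathbf y)|\exp(-A^2|\mathbf y|^2)\le c\int_{\mathbb R^q}|P(\mathbf y)|\exp(-A^2|\mathbf y|^2)\,d\mathbf y.$$ Equivalently, the weights $v_{\mathbf y}=A^q w_{\mathbf y}$ reproduce $A^q\int_{\mathbb R^q}P(\mathbf y)\exp(-A^2|\mathbf y|^2)\,d\mathbf y$ and satisfy $\max|v_{\mathbf y}|\le cA^q\delta_{A,n}(\mathcal C)^q$, $\sum|v_{\mathbf y}|\le cn^q$ and $\sum|v_{\mathbf y}P(\mathbf y)|\exp(-A^2|\mathbf y|^2)\le cA^q\int_{\mathbb R^q}|P(\mathbf y)|\exp(-A^2|\mathbf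 y|^2)\,d\mathbf y$. -/

import Mathlib

open MeasureTheory

noncomputable section

namespace GaussQuad

/-- The cube `[-3n/A, 3n/A]^q`. -/
def cube (q : ℕ) (A n : ℝ) : Set (Fin q → ℝ) :=
  Set.Icc (fun _ => -(3 * n / A)) (fun _ => 3 * n / A)

/-- The mesh norm of `C` relative to the cube: the largest, over points `x` of the cube, of the
distances from `x` to `C`. The distance on `Fin q → ℝ` is that of the maximum norm. It is meant
for nonempty `C`; the supremum is then a maximum and the infimum in `infDist` a minimum. -/
def meshNorm {q : ℕ} (A n : ℝ) (C : Finset (Fin q → ℝ)) : ℝ :=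
  sSup ((fun x => Metric.infDist x (C : Set (Fin q → ℝ))) '' cube q A n)

/-- Real polynomials in `q` variables whose degree in each variable is less than `l ^ 2`. -/
def coordPoly (q : ℕ) (l : ℝ) : Set (MvPolynomial (Fin q) ℝ) :=
  {P | ∀ i, (P.degreeOf i : ℝ) < l ^ 2}

/-- Real polynomials in `q` variables whose total degree is less than `l ^ 2`. -/
def totalPoly (q : ℕ) (l : ℝ) : Set (MvPolynomial (Fin q) ℝ) :=
  {P | (P.totalDegree : ℝ) < l ^ 2}

/-- The Gaussian weight `exp (-A² |y|²)`, with the Euclidean length of `y`. -/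
def gauss {q : ℕ} (A : ℝ) (y : Fin q → ℝ) : ℝ :=
  Real.exp (-(A ^ 2 * ∑ i, y i ^ 2))

/-- The rule with weights `w` on `C` integrates `P(y) exp (-A² |y|²)` exactly. -/
def ExactFor {q : ℕ} (A : ℝ) (C : Finset (Fin q → ℝ)) (w : (Fin q → ℝ) → ℝ)
    (P : MvPolynomial (Fin q) ℝ) : Prop :=
  ∑ y ∈ C, w y * MvPolynomial.eval y P * gauss A y = ∫ y, MvPolynomial.eval y P * gauss A y

end GaussQuad

end

/-! The argument is by duality. Write F(x) = P(x) exp(-A²|x|²). If ∫|F| ≤ 2 Σ μ_y |F(y)| with μ_y ≥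
0 for all admissible P, then P ↦ ∫F factors through the samples, and Hahn–Banach
(`exists_representing_weights`) writes it as Σ w_y F(y) with |w_y| ≤ 2 μ_y. The size bounds for w
are thus bounds for μ, and the last estimate follows from the converse Σ μ_y |F(y)| ≤ 2 ∫|F|. Both
Marcinkiewicz–Zygmund inequalities are `exists_cell_weights`, where μ_y is the volume of the part of
the cube assigned to y as a nearest point. These cells partition the cube, and each lies within the
mesh norm δ of its point.

Comparing the sum with the integral needs two facts: F has little mass outside the cube, and it
oscillates little, in the mean, over displacements of size δ. The oscillation is bounded by
integrals of mixed partial derivatives, each coordinate being differentiated at most once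
(`localVar`). Each derivative costs a factor O(nA) by a one-dimensional Bernstein inequality along
lines and each integration a factor 2δ, so the total is at most (1 + O(δnA))^q - 1 times ∫|F|, which
the mesh condition makes small.

The one-dimensional core is the L¹ Bernstein inequality for p(x) exp(-x²) with deg p ≤ 2n² and
factor O(n) (`global_bernstein`). On [-6n, 6n] a Taylor polynomial of degree O(n²) replaces the
Gaussian up to a constant factor, and the ordinary Bernstein inequality on an interval of length
O(n) then costs O(n²)/n = O(n) (`local_bernstein`). This local form also bounds p(x) exp(-x²) on
[-n, n]; Chebyshev growth carries the bound for p outward, and beyond 3n the Gaussian wins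
(`integral_tail_le`). The tail bound, applied to the derivative, turns the local inequality into the
global one. -/

namespace GaussQuad

/-! ### A discrete formula for the derivative of a trigonometric polynomial -/

open Finset in
theorem sum_cexp_nodes {M : ℕ} (hM : 0 < M) {j : ℤ} (hj : |j| < M) :
    ∑ l ∈ range M, Complex.exp (Complex.I * j * ((2 * Real.pi * l / M : ℝ) : ℂ)) =
      if j = 0 then (M : ℂ) else 0 := by
  split_ifs with h
  · simp [h]
  have hM' : (M : ℂ) ≠ 0 := by exact_mod_cast hM.ne'
  have key : ∀ l : ℕ, Complex.exp (Complex.I * j * ((2 * Real.pi * l / M : ℝ) : ℂ)) =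
      (Complex.exp (2 * Real.pi * Complex.I / M) ^ j) ^ l := by
    intro l
    rw [← Complex.exp_int_mul, ← Complex.exp_nat_mul]
    congr 1
    push_cast
    field_simp
  have hprim := Complex.isPrimitiveRoot_exp M hM.ne'
  have h1 : Complex.exp (2 * Real.pi * Complex.I / M) ^ j ≠ 1 := by
    intro h2
    have := (hprim.zpow_eq_one_iff_dvd j).1 h2
    exact h (Int.eq_zero_of_abs_lt_dvd this hj)
  simp_rw [key]
  rw [geom_sum_eq h1]
  have : (Complex.exp (2 * Real.pi * Complex.I / M) ^ j) ^ M = 1 := by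
    rw [← zpow_natCast, ← zpow_mul, mul_comm j, zpow_mul, zpow_natCast, hprim.pow_eq_one, one_zpow]
  simp [this]

-- For each a at most one b satisfies the equation. The count of pairs is a Fejér coefficient, on
-- the flank where the triangle function is linear or already zero; this linearity is what
-- reproduces the multiplier k of differentiation.
open Finset in
theorem sum_sum_ite_add_eq {N : ℕ} {k : ℤ} (hk : k ≤ N) :
    ∑ a ∈ range N, ∑ b ∈ range N, (if k - N + a - b = 0 then (1 : ℂ) else 0) = (k.toNat : ℂ) := by
  have h : ∀ a ∈ range N, ∑ b ∈ range N, (if k - N + a - b = 0 then (1 : ℂ) else 0) =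
      if N - k ≤ a then 1 else 0 := by
    intro a ha
    rw [mem_range] at ha
    split_ifs with h
    · rw [sum_eq_single (k - N + a).toNat]
      · rw [if_pos (by omega)]
      · intro b _ hb
        rw [if_neg (by omega)]
      · intro hb
        rw [mem_range] at hb
        omega
    · exact sum_eq_zero fun b _ => if_neg (by omega)
  rw [sum_congr rfl h, sum_boole]
  congr 1
  have : (range N).filter (fun a : ℕ => (N : ℤ) - k ≤ a) = Ico (N - k).toNat N := by
    ext a; simp only [mem_filter, mem_range, mem_Ico]; omega
  rw [this, Nat.card_Ico]
  omega

/-- Complex trigonometric polynomials of degree at most `N`. -/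
def trigPoly (N : ℕ) : Submodule ℂ (ℝ → ℂ) :=
  Submodule.span ℂ {f | ∃ k : ℤ, |k| ≤ N ∧ f = fun θ : ℝ => Complex.exp (Complex.I * k * θ)}

open Finset in
/-- Differentiation of trigonometric polynomials is a finite combination of translations. -/
theorem exists_derivative_nodes (N : ℕ) :
    ∃ (M : ℕ) (a : ℕ → ℂ) (t : ℕ → ℝ), ∑ l ∈ range M, ‖a l‖ ≤ 2 * N ∧
      ∀ k : ℤ, |k| ≤ N → ∑ l ∈ range M, a l * Complex.exp (Complex.I * k * t l) = Complex.I * k := by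
  rcases Nat.eq_zero_or_pos N with rfl | hN
  · refine ⟨0, 0, 0, by simp, fun k hk => ?_⟩
    have : k = 0 := by simpa using hk
    simp [this]
  have hM : 0 < 4 * N := by omega
  have hM0 : ((4 * N : ℕ) : ℂ) ≠ 0 := by exact_mod_cast hM.ne'
  -- With 4N nodes there is no aliasing: a shift of at most 2N plus a Fejér frequency a - b stays
  -- below 3N in modulus.
  set t : ℕ → ℝ := fun l => 2 * Real.pi * l / (4 * N : ℕ) with ht
  let e : ℤ → ℕ → ℂ := fun j l => Complex.exp (Complex.I * j * t l)
  have he : ∀ i j l, e i l * e j l = e (i + j) l := by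
    intro i j l
    simp only [e, ← Complex.exp_add]
    congr 1; push_cast; ring
  have hen : ∀ j l, ‖e j l‖ = 1 := by
    intro j l
    have : e j l = Complex.exp (((j * t l : ℝ) : ℂ) * Complex.I) := by
      simp only [e]; congr 1; push_cast; ring
    rw [this, Complex.norm_exp_ofReal_mul_I]
  have hconj : ∀ j l, (starRingEnd ℂ) (e j l) = e (-j) l := by
    intro j l
    simp only [e, ← Complex.exp_conj]
    congr 1; simp
  have hsum : ∀ j : ℤ, |j| < (4 * N : ℕ) →
      ∑ l ∈ range (4 * N), e j l = if j = 0 then ((4 * N : ℕ) : ℂ) else 0 :=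
    fun j hj => sum_cexp_nodes hM hj
  let G : ℕ → ℂ := fun l => ∑ a ∈ range N, ∑ b ∈ range N, e (a - b) l
  have hG : ∀ l, G l = ((‖∑ a ∈ range N, e a l‖ ^ 2 : ℝ) : ℂ) := by
    intro l
    push_cast
    rw [← Complex.mul_conj', map_sum, sum_mul_sum]
    refine sum_congr rfl fun a _ => sum_congr rfl fun b _ => ?_
    rw [hconj, he, sub_eq_add_neg]
  have hGe : ∀ m : ℤ, |m| ≤ 2 * N → ∑ l ∈ range (4 * N), e m l * G l =
      (4 * N : ℕ) * ∑ a ∈ range N, ∑ b ∈ range N, (if m + a - b = 0 then (1 : ℂ) else 0) := by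
    intro m hm
    simp only [G, mul_sum]
    rw [sum_comm]
    refine sum_congr rfl fun a ha => ?_
    rw [sum_comm]
    refine sum_congr rfl fun b hb => ?_
    simp_rw [he]
    rw [mem_range] at ha hb
    rw [abs_le] at hm
    rw [hsum _ (by rw [abs_lt]; constructor <;> push_cast <;> omega)]
    rw [mul_ite, mul_one, mul_zero, add_sub_assoc]
  -- Two Fejér triangles, centred at N and -N and subtracted, give k⁺ - k⁻ = k for |k| ≤ N. Since G
  -- ≥ 0 with mean N over the nodes, the coefficients have total mass at most 2N.
  refine ⟨4 * N, fun l => Complex.I / (4 * N : ℕ) * (e (-N) l - e N l) * G l, t, ?_, ?_⟩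
  · have hb : ∀ l ∈ range (4 * N), ‖Complex.I / (4 * N : ℕ) * (e (-N) l - e N l) * G l‖ ≤
        (2 / (4 * N : ℕ) : ℝ) * (G l).re := by
      intro l _
      rw [norm_mul, norm_mul, norm_div, Complex.norm_I, hG l, Complex.ofReal_re,
        Complex.norm_real, Complex.norm_natCast, Real.norm_of_nonneg (by positivity)]
      have : ‖e (-N) l - e N l‖ ≤ 2 := by
        refine (norm_sub_le _ _).trans ?_
        rw [hen, hen]; norm_num
      calc 1 / ((4 * N : ℕ) : ℝ) * ‖e (-N) l - e N l‖ * ‖∑ a ∈ range N, e a l‖ ^ 2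
          ≤ 1 / ((4 * N : ℕ) : ℝ) * 2 * ‖∑ a ∈ range N, e a l‖ ^ 2 := by gcongr
        _ = _ := by ring
    refine (sum_le_sum hb).trans ?_
    rw [← mul_sum, ← Complex.re_sum]
    have h0 := hGe 0 (by simp)
    have h1 : ∑ a ∈ range N, ∑ b ∈ range N, (if (0 : ℤ) + a - b = 0 then (1 : ℂ) else 0) = N := by
      have := sum_sum_ite_add_eq (N := N) (k := N) le_rfl
      simpa using this
    rw [h1] at h0
    have h2 : ∑ l ∈ range (4 * N), G l = ((4 * N : ℕ) * N : ℂ) := by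
      rw [← h0]
      refine sum_congr rfl fun l _ => ?_
      simp [e]
    rw [h2]
    have h3 : (((4 * N : ℕ) * N : ℂ)).re = (4 * N : ℕ) * N := by
      rw [← Complex.ofReal_natCast, ← Complex.ofReal_natCast, ← Complex.ofReal_mul,
        Complex.ofReal_re]
    rw [h3]
    have : ((4 * N : ℕ) : ℝ) ≠ 0 := by exact_mod_cast hM.ne'
    apply le_of_eq
    field_simp
  · intro k hk
    rw [abs_le] at hk
    have h1 : ∀ l, Complex.I / (4 * N : ℕ) * (e (-N) l - e N l) * G l *
        Complex.exp (Complex.I * k * t l) =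
        Complex.I / (4 * N : ℕ) * (e (k - N) l * G l - e (k + N) l * G l) := by
      intro l
      have : Complex.exp (Complex.I * k * t l) = e k l := rfl
      rw [this, sub_eq_add_neg k, add_comm k, add_comm k, ← he, ← he]
      ring
    simp_rw [h1]
    rw [← mul_sum, sum_sub_distrib, hGe _ (by rw [abs_le]; constructor <;> omega),
      hGe _ (by rw [abs_le]; constructor <;> omega), sum_sum_ite_add_eq hk.2]
    have h2 : ∑ a ∈ range N, ∑ b ∈ range N, (if k + N + a - b = 0 then (1 : ℂ) else 0) =
        ((-k).toNat : ℂ) := by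
      rw [← sum_sum_ite_add_eq (N := N) (k := -k) (by omega), sum_comm]
      refine sum_congr rfl fun b _ => sum_congr rfl fun a _ => ?_
      congr 1
      apply propext
      omega
    rw [h2]
    have h3 : (k : ℂ) = (k.toNat : ℂ) - ((-k).toNat : ℂ) := by
      have := Int.toNat_sub_toNat_neg k
      exact_mod_cast this.symm
    rw [h3]
    field_simp

/-! ### Trigonometric polynomials and their L¹ Bernstein inequality -/

theorem trigPoly_mono {N N' : ℕ} (h : N ≤ N') : trigPoly N ≤ trigPoly N' := by
  apply Submodule.span_mono
  rintro f ⟨k, hk, rfl⟩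
  exact ⟨k, hk.trans (by exact_mod_cast h), rfl⟩

theorem continuous_of_mem_trigPoly {N : ℕ} {f : ℝ → ℂ} (hf : f ∈ trigPoly N) : Continuous f := by
  induction hf using Submodule.span_induction with
  | mem f h => obtain ⟨k, -, rfl⟩ := h; fun_prop
  | zero => exact continuous_const
  | add f g _ _ hf hg => exact hf.add hg
  | smul c f _ hf => exact hf.const_smul c

theorem periodic_of_mem_trigPoly {N : ℕ} {f : ℝ → ℂ} (hf : f ∈ trigPoly N) :
    Function.Periodic f (2 * Real.pi) := by
  induction hf using Submodule.span_induction with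
  | mem f h =>
    obtain ⟨k, -, rfl⟩ := h
    intro x
    have : Complex.I * k * ((x + 2 * Real.pi : ℝ) : ℂ) =
        Complex.I * k * x + k * (2 * Real.pi * Complex.I) := by push_cast; ring
    simp only [this, Complex.exp_add, Complex.exp_int_mul_two_pi_mul_I, mul_one]
  | zero => intro x; rfl
  | add f g _ _ hf hg => exact hf.add hg
  | smul c f _ hf => intro x; simp [hf x]

theorem mul_cexp_mem_trigPoly {N : ℕ} {f : ℝ → ℂ} (hf : f ∈ trigPoly N) {j : ℤ} (hj : |j| ≤ 1) :
    (fun θ : ℝ => f θ * Complex.exp (Complex.I * j * θ)) ∈ trigPoly (N + 1) := by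
  induction hf using Submodule.span_induction with
  | mem f h =>
    obtain ⟨k, hk, rfl⟩ := h
    refine Submodule.subset_span ⟨k + j, ?_, ?_⟩
    · push_cast; exact (abs_add_le _ _).trans (add_le_add hk hj)
    · funext θ
      rw [← Complex.exp_add]; congr 1; push_cast; ring
  | zero => convert (trigPoly (N + 1)).zero_mem using 1; funext θ; simp
  | add f g _ _ hf hg =>
    convert (trigPoly (N + 1)).add_mem hf hg using 1
    funext θ; simp [add_mul]
  | smul c f _ hf =>
    convert (trigPoly (N + 1)).smul_mem c hf using 1
    funext θ; simp [mul_assoc]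

theorem mul_sin_mem_trigPoly {N : ℕ} {f : ℝ → ℂ} (hf : f ∈ trigPoly N) :
    (fun θ : ℝ => f θ * (Real.sin θ : ℂ)) ∈ trigPoly (N + 1) := by
  have h1 := mul_cexp_mem_trigPoly hf (j := 1) (by simp)
  have h2 := mul_cexp_mem_trigPoly hf (j := -1) (by simp)
  convert (trigPoly (N + 1)).smul_mem (Complex.I / 2) ((trigPoly (N + 1)).sub_mem h2 h1) using 1
  funext θ
  simp only [Pi.smul_apply, Pi.sub_apply, smul_eq_mul, Complex.ofReal_sin, Complex.sin]
  push_cast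
  rw [show -(θ : ℂ) * Complex.I = Complex.I * -1 * θ by ring,
    show (θ : ℂ) * Complex.I = Complex.I * 1 * θ by ring]
  ring

theorem mul_cos_mem_trigPoly {N : ℕ} {f : ℝ → ℂ} (hf : f ∈ trigPoly N) :
    (fun θ : ℝ => f θ * (Real.cos θ : ℂ)) ∈ trigPoly (N + 1) := by
  have h1 := mul_cexp_mem_trigPoly hf (j := 1) (by simp)
  have h2 := mul_cexp_mem_trigPoly hf (j := -1) (by simp)
  convert (trigPoly (N + 1)).smul_mem (1 / 2) ((trigPoly (N + 1)).add_mem h1 h2) using 1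
  funext θ
  simp only [Pi.smul_apply, Pi.add_apply, smul_eq_mul, Complex.ofReal_cos, Complex.cos]
  push_cast
  rw [show -(θ : ℂ) * Complex.I = Complex.I * -1 * θ by ring,
    show (θ : ℂ) * Complex.I = Complex.I * 1 * θ by ring]
  ring

theorem one_mem_trigPoly : (fun _ => 1 : ℝ → ℂ) ∈ trigPoly 0 :=
  Submodule.subset_span ⟨0, by simp, by simp⟩

theorem sin_pow_mem_trigPoly (N : ℕ) : (fun θ : ℝ => (Real.sin θ : ℂ) ^ N) ∈ trigPoly N := by
  induction N with
  | zero => simpa using one_mem_trigPoly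
  | succ N ih => simpa only [pow_succ] using mul_sin_mem_trigPoly ih

/-- The factor cos θ is, up to L, the Jacobian of x = L sin θ, so the L¹ norm of this function
becomes an unweighted L¹ norm of p. -/
theorem eval_sin_mul_cos_mem_trigPoly (p : Polynomial ℝ) (L : ℝ) :
    (fun θ : ℝ => ((p.eval (L * Real.sin θ) * Real.cos θ : ℝ) : ℂ)) ∈
      trigPoly (p.natDegree + 1) := by
  have : (fun θ : ℝ => ((p.eval (L * Real.sin θ) : ℝ) : ℂ)) ∈ trigPoly p.natDegree := by
    have h : (fun θ : ℝ => ((p.eval (L * Real.sin θ) : ℝ) : ℂ)) =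
        ∑ k ∈ Finset.range (p.natDegree + 1),
          ((p.coeff k * L ^ k : ℝ) : ℂ) • fun θ : ℝ => (Real.sin θ : ℂ) ^ k := by
      funext θ
      rw [Polynomial.eval_eq_sum_range]
      simp [mul_pow, mul_assoc]
    rw [h]
    refine Submodule.sum_mem _ fun k hk => Submodule.smul_mem _ _ ?_
    exact trigPoly_mono (by simpa [Nat.lt_succ_iff] using hk) (sin_pow_mem_trigPoly k)
  simpa using mul_cos_mem_trigPoly this

open Finset in
/-- Bernstein's inequality in `L¹`, with constant `2`. -/
theorem exists_hasDerivAt_trigPoly {N : ℕ} {f : ℝ → ℂ} (hf : f ∈ trigPoly N) :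
    ∃ f' : ℝ → ℂ, Continuous f' ∧ (∀ θ, HasDerivAt f (f' θ) θ) ∧
      ∫ θ in -Real.pi..Real.pi, ‖f' θ‖ ≤ 2 * N * ∫ θ in -Real.pi..Real.pi, ‖f θ‖ := by
  obtain ⟨M, a, t, ha, hk⟩ := exists_derivative_nodes N
  have hc := continuous_of_mem_trigPoly hf
  have hp := periodic_of_mem_trigPoly hf
  refine ⟨fun θ => ∑ l ∈ range M, a l * f (θ + t l), by fun_prop, ?_, ?_⟩
  · clear hc hp
    induction hf using Submodule.span_induction with
    | mem f h =>
      obtain ⟨k, hk', rfl⟩ := h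
      intro θ
      have h1 : ∑ l ∈ range M, a l * Complex.exp (Complex.I * k * ((θ + t l : ℝ) : ℂ)) =
          Complex.exp (Complex.I * k * θ) * (Complex.I * k) := by
        have h0 := congrArg (Complex.exp (Complex.I * k * θ) * ·) (hk k hk')
        simp only [mul_sum] at h0
        rw [← h0]
        refine sum_congr rfl fun l _ => ?_
        push_cast
        rw [mul_add, Complex.exp_add]; ring
      simp only [h1]
      have h2 : HasDerivAt (fun θ : ℝ => Complex.I * k * (θ : ℂ)) (Complex.I * k) θ := by
        simpa using (Complex.ofRealCLM.hasDerivAt (x := θ)).const_mul (Complex.I * (k : ℂ))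
      exact h2.cexp
    | zero => intro θ; simp only [Pi.zero_apply, mul_zero, sum_const_zero]; exact hasDerivAt_const θ 0
    | add f g _ _ hf hg =>
      intro θ
      refine ((hf θ).add (hg θ)).congr_deriv ?_
      simp [mul_add, sum_add_distrib]
    | smul c f _ hf =>
      intro θ
      refine ((hf θ).const_smul c).congr_deriv ?_
      simp only [Pi.smul_apply, smul_eq_mul, mul_sum]
      exact sum_congr rfl fun l _ => by ring
  · have hle : -Real.pi ≤ Real.pi := by linarith [Real.pi_pos]
    have hshift : ∀ s : ℝ, ∫ θ in -Real.pi..Real.pi, ‖f (θ + s)‖ =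
        ∫ θ in -Real.pi..Real.pi, ‖f θ‖ := by
      intro s
      have hp' : Function.Periodic (fun θ => ‖f θ‖) (2 * Real.pi) := fun x => by simp [hp x]
      rw [intervalIntegral.integral_comp_add_right (fun θ => ‖f θ‖)]
      have := hp'.intervalIntegral_add_eq (-Real.pi + s) (-Real.pi)
      convert this using 2 <;> ring
    calc ∫ θ in -Real.pi..Real.pi, ‖∑ l ∈ range M, a l * f (θ + t l)‖
        ≤ ∫ θ in -Real.pi..Real.pi, ∑ l ∈ range M, ‖a l‖ * ‖f (θ + t l)‖ := by
          refine intervalIntegral.integral_mono_on hle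
            (Continuous.intervalIntegrable (by fun_prop) _ _)
            (Continuous.intervalIntegrable (by fun_prop) _ _) fun θ _ => ?_
          exact (norm_sum_le _ _).trans (by simp)
      _ = (∑ l ∈ range M, ‖a l‖) * ∫ θ in -Real.pi..Real.pi, ‖f θ‖ := by
          rw [intervalIntegral.integral_finsetSum
            fun l _ => Continuous.intervalIntegrable (by fun_prop) _ _, sum_mul]
          refine sum_congr rfl fun l _ => ?_
          rw [intervalIntegral.integral_const_mul, hshift]
      _ ≤ _ := by
          gcongr
          exact intervalIntegral.integral_nonneg hle fun θ _ => norm_nonneg _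

/-! ### From trigonometric to algebraic polynomials on an interval -/

theorem integral_comp_sin {g : ℝ → ℝ} (hg : Continuous g) (L a b : ℝ) :
    ∫ θ in a..b, g (L * Real.sin θ) * (L * Real.cos θ) =
      ∫ x in L * Real.sin a..L * Real.sin b, g x :=
  intervalIntegral.integral_comp_mul_deriv (f := fun θ => L * Real.sin θ)
    (fun θ _ => (Real.hasDerivAt_sin θ).const_mul L) (by fun_prop) hg

/-- Over one period L sin θ runs through [-L, L] twice; the reflection θ ↦ π - θ exchanges the two
passages. -/
theorem integral_abs_eval_sin_mul_cos (p : Polynomial ℝ) {L : ℝ} (hL : 0 < L) :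
    ∫ θ in -Real.pi..Real.pi, |p.eval (L * Real.sin θ) * Real.cos θ| =
      2 / L * ∫ x in -L..L, |p.eval x| := by
  set T : ℝ → ℝ := fun θ => |p.eval (L * Real.sin θ) * Real.cos θ| with hT
  have hTc : Continuous T := by
    have := p.continuous
    fun_prop
  have hper : Function.Periodic T (2 * Real.pi) := fun x => by simp [hT]
  have h1 : ∫ θ in -Real.pi..Real.pi, T θ =
      ∫ θ in -(Real.pi / 2)..(3 * Real.pi / 2), T θ := by
    have := hper.intervalIntegral_add_eq (-Real.pi) (-(Real.pi / 2))
    convert this using 2 <;> ring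
  have h2 : ∫ θ in (Real.pi / 2)..(3 * Real.pi / 2), T θ =
      ∫ θ in -(Real.pi / 2)..(Real.pi / 2), T θ := by
    have h := intervalIntegral.integral_comp_sub_left (a := -(Real.pi / 2)) (b := Real.pi / 2)
      T Real.pi
    have h' : ∀ x, T (Real.pi - x) = T x := fun x => by
      simp [hT, Real.sin_pi_sub, Real.cos_pi_sub]
    simp only [h'] at h
    rw [h]
    congr 1 <;> ring
  have h3 : ∫ θ in -(Real.pi / 2)..(Real.pi / 2), T θ = 1 / L * ∫ x in -L..L, |p.eval x| := by
    have h := integral_comp_sin (g := fun x => |p.eval x|) p.continuous.abs L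
      (-(Real.pi / 2)) (Real.pi / 2)
    simp only [Real.sin_neg, Real.sin_pi_div_two, mul_neg, mul_one] at h
    rw [← h, ← intervalIntegral.integral_const_mul]
    refine intervalIntegral.integral_congr fun θ hθ => ?_
    rw [Set.uIcc_of_le (by linarith [Real.pi_pos])] at hθ
    simp only [hT]
    rw [abs_mul, abs_of_nonneg (Real.cos_nonneg_of_mem_Icc hθ)]
    field_simp
  rw [h1, ← intervalIntegral.integral_add_adjacent_intervals
    (hTc.intervalIntegrable _ (Real.pi / 2)) (hTc.intervalIntegrable _ _), h2, h3]
  ring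

/-- An `L¹` Bernstein inequality for algebraic polynomials in the middle half of an interval. -/
theorem integral_abs_derivative_le (p : Polynomial ℝ) {L : ℝ} (hL : 0 < L) :
    ∫ x in -(L / 2)..L / 2, |p.derivative.eval x| ≤
      (8 * p.natDegree + 12) / L * ∫ x in -L..L, |p.eval x| := by
  have hpc := p.continuous
  have hpc' := p.derivative.continuous
  have hpi := Real.pi_pos
  obtain ⟨f', hc', hd, hb⟩ := exists_hasDerivAt_trigPoly (eval_sin_mul_cos_mem_trigPoly p L)
  simp only [Complex.norm_real, Real.norm_eq_abs] at hb
  rw [integral_abs_eval_sin_mul_cos p hL] at hb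
  have hf' : ∀ θ, f' θ = ((p.derivative.eval (L * Real.sin θ) * L * Real.cos θ ^ 2 -
      p.eval (L * Real.sin θ) * Real.sin θ : ℝ) : ℂ) := by
    intro θ
    refine (hd θ).unique ?_
    have h1 : HasDerivAt (fun θ => L * Real.sin θ) (L * Real.cos θ) θ :=
      (Real.hasDerivAt_sin θ).const_mul L
    have h2 := ((p.hasDerivAt (L * Real.sin θ)).comp θ h1).mul (Real.hasDerivAt_cos θ)
    refine (h2.congr_deriv ?_).ofReal_comp
    simp only [Function.comp]; ring
  have hs := integral_comp_sin (g := fun x => |p.derivative.eval x|) hpc'.abs L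
      (-(Real.pi / 6)) (Real.pi / 6)
  rw [Real.sin_neg, Real.sin_pi_div_six, show L * -(1 / 2) = -(L / 2) by ring,
    show L * (1 / 2) = L / 2 by ring] at hs
  rw [← hs]
  set T : ℝ → ℝ := fun θ => |p.eval (L * Real.sin θ) * Real.cos θ| with hT
  have hTc : Continuous T := by fun_prop
  have hii : ∀ a b, IntervalIntegrable (fun θ => 2 * ‖f' θ‖ + 2 * T θ) volume a b := fun a b =>
    Continuous.intervalIntegrable (by fun_prop) a b
  calc ∫ θ in -(Real.pi / 6)..(Real.pi / 6),
        |p.derivative.eval (L * Real.sin θ)| * (L * Real.cos θ)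
      ≤ ∫ θ in -(Real.pi / 6)..(Real.pi / 6), (2 * ‖f' θ‖ + 2 * T θ) := by
        refine intervalIntegral.integral_mono_on (by linarith)
          (Continuous.intervalIntegrable (by fun_prop) _ _) (hii _ _) fun θ hθ => ?_
        -- The range |θ| ≤ π/6 corresponds to |x| ≤ L/2. There cos θ ≥ 1/2 pays for the extra cosine
        -- in the derivative, and |sin θ| ≤ cos θ absorbs the term without p'.
        have hcos : 1 / 2 ≤ Real.cos θ := by
          rw [← Real.cos_pi_div_three, ← Real.cos_abs θ]
          exact Real.cos_le_cos_of_nonneg_of_le_pi (abs_nonneg θ) (by linarith)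
            ((abs_le.2 hθ).trans (by linarith))
        have hsin : |Real.sin θ| ≤ Real.cos θ := by
          apply abs_le_of_sq_le_sq _ (by linarith)
          have := Real.sin_sq_add_cos_sq θ
          have h4 : Real.cos θ = Real.cos |θ| := (Real.cos_abs θ).symm
          have h5 : Real.cos (Real.pi / 4) ≤ Real.cos |θ| :=
            Real.cos_le_cos_of_nonneg_of_le_pi (abs_nonneg θ) (by linarith)
              ((abs_le.2 hθ).trans (by linarith))
          rw [← h4, Real.cos_pi_div_four] at h5
          have h6 : (0:ℝ) ≤ √2 / 2 := by positivity
          have h7 : (√2) ^ 2 = 2 := Real.sq_sqrt (by norm_num)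
          nlinarith
        have hcos0 : 0 < Real.cos θ := by linarith
        simp only [hT]
        rw [hf' θ, Complex.norm_real, Real.norm_eq_abs]
        set u := p.derivative.eval (L * Real.sin θ)
        set v := p.eval (L * Real.sin θ)
        have e1 : |u * L * Real.cos θ ^ 2| = |u| * L * Real.cos θ * Real.cos θ := by
          rw [abs_mul, abs_mul, abs_of_pos hL, abs_of_nonneg (sq_nonneg (Real.cos θ))]; ring
        have e2 : |v * Real.sin θ| ≤ |v * Real.cos θ| := by
          rw [abs_mul, abs_mul, abs_of_pos hcos0]; gcongr
        have e3 := abs_sub_abs_le_abs_sub (u * L * Real.cos θ ^ 2) (v * Real.sin θ)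
        have e4 : 0 ≤ |u| * L * Real.cos θ := by positivity
        nlinarith
    _ ≤ ∫ θ in -Real.pi..Real.pi, (2 * ‖f' θ‖ + 2 * T θ) := by
        refine intervalIntegral.integral_mono_interval (by linarith) (by linarith) (by linarith)
          (Filter.Eventually.of_forall fun θ => ?_) (hii _ _)
        simp only [hT, Pi.zero_apply]; positivity
    _ = 2 * (∫ θ in -Real.pi..Real.pi, ‖f' θ‖) + 2 * ∫ θ in -Real.pi..Real.pi, T θ := by
        rw [intervalIntegral.integral_add (Continuous.intervalIntegrable (by fun_prop) _ _)
          (Continuous.intervalIntegrable (by fun_prop) _ _),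
          intervalIntegral.integral_const_mul, intervalIntegral.integral_const_mul]
    _ ≤ 2 * (2 * ↑(p.natDegree + 1) * (2 / L * ∫ x in -L..L, |p.eval x|)) +
          2 * (2 / L * ∫ x in -L..L, |p.eval x|) := by
        rw [integral_abs_eval_sin_mul_cos p hL]
        gcongr
    _ = _ := by push_cast; ring

/-! ### Taylor polynomials in place of the Gaussian -/

-- Rankin's trick: on the tail m ≥ M each term may be multiplied by exp(m - M) ≥ 1, and the enlarged
-- series sums to an exponential.
open Finset in
theorem exp_sub_sum_le (M : ℕ) {y : ℝ} (hy : 0 ≤ y) :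
    Real.exp y - ∑ m ∈ range M, y ^ m / m.factorial ≤ Real.exp (Real.exp 1 * y - M) := by
  have hs : ∀ z : ℝ, HasSum (fun m : ℕ => z ^ m / m.factorial) (Real.exp z) := by
    intro z
    rw [Real.exp_eq_exp_ℝ]
    exact NormedSpace.expSeries_div_hasSum_exp z
  have h1 := (hasSum_nat_add_iff' M).2 (hs y)
  have h2 := ((hasSum_nat_add_iff' M).2 (hs (Real.exp 1 * y))).mul_left (Real.exp (-M))
  refine (hasSum_le (fun m => ?_) h1 h2).trans ?_
  · rw [mul_pow, ← Real.exp_nat_mul, mul_div_assoc, ← mul_assoc, ← Real.exp_add]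
    refine le_mul_of_one_le_left (by positivity) (Real.one_le_exp ?_)
    push_cast; simp
  · rw [sub_eq_add_neg (Real.exp 1 * y), add_comm (Real.exp 1 * y), Real.exp_add]
    gcongr
    have : 0 ≤ ∑ m ∈ range M, (Real.exp 1 * y) ^ m / m.factorial :=
      sum_nonneg fun m _ => by positivity
    linarith

/-- The Taylor polynomial of `exp (-x²)` with `M` terms. -/
noncomputable def gaussTaylor (M : ℕ) : Polynomial ℝ :=
  ∑ k ∈ Finset.range M, Polynomial.C ((-1) ^ k / (k.factorial : ℝ)) * Polynomial.X ^ (2 * k)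

theorem eval_gaussTaylor (M : ℕ) (x : ℝ) :
    (gaussTaylor M).eval x = ∑ k ∈ Finset.range M, (-x ^ 2) ^ k / k.factorial := by
  rw [gaussTaylor, Polynomial.eval_finsetSum]
  refine Finset.sum_congr rfl fun k _ => ?_
  simp only [Polynomial.eval_mul, Polynomial.eval_C, Polynomial.eval_pow, Polynomial.eval_X]
  rw [neg_pow (x ^ 2), ← pow_mul]
  ring

theorem natDegree_gaussTaylor_le (M : ℕ) : (gaussTaylor M).natDegree ≤ 2 * M := by
  refine Polynomial.natDegree_sum_le_of_forall_le _ _ fun k hk => ?_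
  refine (Polynomial.natDegree_C_mul_X_pow_le _ _).trans ?_
  have := Finset.mem_range.1 hk
  omega

/-- Mirrors (exp(-x²))' = -2x exp(-x²) with one term fewer, so the derivative is again comparable to
the Gaussian. -/
theorem derivative_gaussTaylor (M : ℕ) :
    (gaussTaylor (M + 1)).derivative = -(2 * Polynomial.X * gaussTaylor M) := by
  rw [gaussTaylor, Finset.sum_range_succ', Polynomial.derivative_add, Polynomial.derivative_sum,
    gaussTaylor, Finset.mul_sum, ← Finset.sum_neg_distrib]
  simp only [Nat.mul_zero, pow_zero, mul_one, Polynomial.derivative_C, add_zero]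
  refine Finset.sum_congr rfl fun k _ => ?_
  rw [Polynomial.derivative_C_mul_X_pow, show 2 * (k + 1) - 1 = 2 * k + 1 by omega]
  have : (-1 : ℝ) ^ (k + 1) / ((k + 1).factorial : ℝ) * ((2 * (k + 1) : ℕ) : ℝ) =
      -(2 * ((-1) ^ k / (k.factorial : ℝ))) := by
    rw [Nat.factorial_succ]
    have h1 : (k.factorial : ℝ) ≠ 0 := by positivity
    have h2 : (k : ℝ) + 1 ≠ 0 := by positivity
    push_cast
    field_simp
    ring
  rw [this, Polynomial.C_neg, Polynomial.C_mul, show (Polynomial.C (2 : ℝ)) = 2 from rfl]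
  ring

/-- The remainder is at most exp(e x² - M), so M ≥ (e + 1) x² + 1 suffices; with x² ≤ 36n² and n ≥
1, 135n² exceeds this. -/
theorem abs_eval_gaussTaylor_sub_le {n : ℝ} (hn : 1 ≤ n) {M : ℕ} (hM : 135 * n ^ 2 ≤ M) {x : ℝ}
    (hx : |x| ≤ 6 * n) :
    |(gaussTaylor M).eval x - Real.exp (-x ^ 2)| ≤ Real.exp (-x ^ 2) / 2 := by
  have h1 := Complex.norm_exp_sub_sum_le_exp_norm_sub_sum ((-x ^ 2 : ℝ) : ℂ) M
  have h2 : Complex.exp ((-x ^ 2 : ℝ) : ℂ) -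
      ∑ m ∈ Finset.range M, ((-x ^ 2 : ℝ) : ℂ) ^ m / m.factorial =
      ((Real.exp (-x ^ 2) - (gaussTaylor M).eval x : ℝ) : ℂ) := by
    rw [eval_gaussTaylor]; push_cast; rfl
  rw [h2, Complex.norm_real, Complex.norm_real, Real.norm_eq_abs, Real.norm_eq_abs, abs_neg,
    abs_of_nonneg (sq_nonneg x), abs_sub_comm] at h1
  refine (h1.trans (exp_sub_sum_le M (sq_nonneg x))).trans ?_
  have h3 : x ^ 2 ≤ 36 * n ^ 2 := by
    have := sq_le_sq' (by linarith [abs_nonneg x]) hx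
    rw [sq_abs] at this
    linarith [this]
  have h4 : Real.exp 1 < 2.72 := by linarith [Real.exp_one_lt_d9]
  have h5 : Real.exp (-1) ≤ 1 / 2 := by
    rw [Real.exp_neg, inv_eq_one_div]
    exact one_div_le_one_div_of_le (by norm_num) (by linarith [Real.exp_one_gt_d9])
  have h6 : Real.exp 1 * x ^ 2 ≤ 2.72 * x ^ 2 := by gcongr
  calc Real.exp (Real.exp 1 * x ^ 2 - M) ≤ Real.exp (-x ^ 2 + -1) := by
        apply Real.exp_le_exp.2
        nlinarith
    _ ≤ _ := by
        rw [Real.exp_add]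
        have := Real.exp_pos (-x ^ 2)
        nlinarith

/-! ### The local Bernstein inequality for weighted polynomials -/

/-- The polynomial factor of the derivative of `p * exp (-x²)`. -/
noncomputable def gaussDeriv (p : Polynomial ℝ) : Polynomial ℝ :=
  p.derivative - 2 * Polynomial.X * p

theorem hasDerivAt_mul_gauss (p : Polynomial ℝ) (x : ℝ) :
    HasDerivAt (fun x => p.eval x * Real.exp (-x ^ 2))
      ((gaussDeriv p).eval x * Real.exp (-x ^ 2)) x := by
  have h1 : HasDerivAt (fun x : ℝ => -x ^ 2) (-(2 * x)) x := by
    simpa using (hasDerivAt_pow 2 x).fun_neg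
  refine ((p.hasDerivAt x).mul h1.exp).congr_deriv ?_
  simp only [gaussDeriv, Polynomial.eval_sub, Polynomial.eval_mul, Polynomial.eval_ofNat,
    Polynomial.eval_X]
  ring

theorem natDegree_gaussDeriv_le (p : Polynomial ℝ) :
    (gaussDeriv p).natDegree ≤ p.natDegree + 1 := by
  refine (Polynomial.natDegree_sub_le _ _).trans (max_le ?_ ?_)
  · exact (Polynomial.natDegree_derivative_le p).trans (by omega)
  · refine Polynomial.natDegree_mul_le.trans ?_
    have : (2 * Polynomial.X : Polynomial ℝ).natDegree ≤ 1 := by compute_degree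
    omega

theorem continuous_mul_gauss (p : Polynomial ℝ) :
    Continuous fun x => p.eval x * Real.exp (-x ^ 2) := by
  have := p.continuous
  fun_prop

/-- The interval Bernstein inequality is applied to p times a Taylor polynomial of the Gaussian. The
degree bound 3n² leaves room for the derivative of a weighted polynomial of degree 2n². -/
theorem local_bernstein {n : ℝ} (hn : 1 ≤ n) (p : Polynomial ℝ) (hp : p.natDegree ≤ 3 * n ^ 2) :
    ∫ x in -(3 * n)..3 * n, |(gaussDeriv p).eval x * Real.exp (-x ^ 2)| ≤
      1200 * n * ∫ x in -(6 * n)..6 * n, |p.eval x * Real.exp (-x ^ 2)| := by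
  set M := ⌈135 * n ^ 2⌉₊ with hMdef
  have hM : 135 * n ^ 2 ≤ M := Nat.le_ceil _
  have hM' : (M : ℝ) < 135 * n ^ 2 + 1 := Nat.ceil_lt_add_one (by positivity)
  set R := gaussTaylor (M + 1) with hR
  set g := p * R with hg
  have hc := continuous_mul_gauss p
  have hc' := continuous_mul_gauss (gaussDeriv p)
  have hgc := g.continuous
  have hgc' := g.derivative.continuous
  have hdeg : (g.natDegree : ℝ) ≤ 277 * n ^ 2 := by
    have h1 : g.natDegree ≤ p.natDegree + 2 * (M + 1) :=
      Polynomial.natDegree_mul_le.trans (by gcongr; exact natDegree_gaussTaylor_le _)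
    have h2 : (g.natDegree : ℝ) ≤ p.natDegree + 2 * (M + 1) := by exact_mod_cast h1
    nlinarith
  have hmain := integral_abs_derivative_le g (L := 6 * n) (by linarith)
  rw [show 6 * n / 2 = 3 * n by ring] at hmain
  set I := ∫ x in -(6 * n)..6 * n, |p.eval x * Real.exp (-x ^ 2)| with hI
  have hI0 : 0 ≤ I := intervalIntegral.integral_nonneg (by linarith) fun x _ => abs_nonneg _
  have hgI : ∫ x in -(6 * n)..6 * n, |g.eval x| ≤ 3 / 2 * I := by
    rw [hI, ← intervalIntegral.integral_const_mul]
    refine intervalIntegral.integral_mono_on (by linarith)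
      (Continuous.intervalIntegrable (by fun_prop) _ _)
      (Continuous.intervalIntegrable (by fun_prop) _ _) fun x hx => ?_
    have h := abs_eval_gaussTaylor_sub_le hn (M := M + 1) (by push_cast; linarith) (abs_le.2 hx)
    have hw := Real.exp_pos (-x ^ 2)
    rw [hg, Polynomial.eval_mul, abs_mul, abs_mul, abs_of_pos hw]
    have : |R.eval x| ≤ 3 / 2 * Real.exp (-x ^ 2) := by
      have := abs_sub_abs_le_abs_sub (R.eval x) (Real.exp (-x ^ 2))
      rw [abs_of_pos hw] at this
      linarith
    have := mul_le_mul_of_nonneg_left this (abs_nonneg (p.eval x))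
    linarith
  have hII : ∫ x in -(3 * n)..3 * n, |p.eval x * Real.exp (-x ^ 2)| ≤ I :=
    intervalIntegral.integral_mono_interval (by linarith) (by linarith) (by linarith)
      (Filter.Eventually.of_forall fun θ => abs_nonneg _)
      (Continuous.intervalIntegrable (by fun_prop) _ _)
  calc ∫ x in -(3 * n)..3 * n, |(gaussDeriv p).eval x * Real.exp (-x ^ 2)|
      ≤ ∫ x in -(3 * n)..3 * n,
          (2 * |g.derivative.eval x| + 24 * n * |p.eval x * Real.exp (-x ^ 2)|) := by
        refine intervalIntegral.integral_mono_on (by linarith)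
          (Continuous.intervalIntegrable (by fun_prop) _ _)
          (Continuous.intervalIntegrable (by fun_prop) _ _) fun x hx => ?_
        have hx3 : |x| ≤ 3 * n := abs_le.2 hx
        have hx6 : |x| ≤ 6 * n := by linarith
        have hw := Real.exp_pos (-x ^ 2)
        have h1 := abs_eval_gaussTaylor_sub_le hn (M := M + 1) (by push_cast; linarith) hx6
        have h2 := abs_eval_gaussTaylor_sub_le hn hM hx6
        set w := Real.exp (-x ^ 2)
        have h3 : w / 2 ≤ |R.eval x| := by
          have := abs_sub_abs_le_abs_sub w (R.eval x)
          rw [abs_of_pos hw, abs_sub_comm] at this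
          linarith
        have h4 : |(gaussTaylor M).eval x| ≤ 3 / 2 * w := by
          have := abs_sub_abs_le_abs_sub ((gaussTaylor M).eval x) w
          rw [abs_of_pos hw] at this
          linarith
        -- Solving for p' needs a lower bound for `R` and an upper bound for the shorter Taylor
        -- polynomial, hence the comparison at both M + 1 and M.
        have h5 : g.derivative.eval x = p.derivative.eval x * R.eval x -
            2 * x * p.eval x * (gaussTaylor M).eval x := by
          rw [hg, Polynomial.derivative_mul, hR, derivative_gaussTaylor]
          simp only [Polynomial.eval_add, Polynomial.eval_mul, Polynomial.eval_neg,
            Polynomial.eval_ofNat, Polynomial.eval_X]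
          ring
        have h6 : |p.derivative.eval x| * (w / 2) ≤
            |g.derivative.eval x| + 9 * n * (|p.eval x| * w) := by
          have e1 : p.derivative.eval x * R.eval x = g.derivative.eval x +
            2 * x * p.eval x * (gaussTaylor M).eval x := by rw [h5]; ring
          calc |p.derivative.eval x| * (w / 2) ≤ |p.derivative.eval x| * |R.eval x| := by gcongr
            _ = |g.derivative.eval x + 2 * x * p.eval x * (gaussTaylor M).eval x| := by
              rw [← abs_mul, e1]
            _ ≤ |g.derivative.eval x| + |2 * x * p.eval x * (gaussTaylor M).eval x| :=
              abs_add_le _ _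
            _ = |g.derivative.eval x| + 2 * |x| * |p.eval x| * |(gaussTaylor M).eval x| := by
              rw [abs_mul, abs_mul, abs_mul, abs_two]
            _ ≤ |g.derivative.eval x| + 2 * (3 * n) * |p.eval x| * (3 / 2 * w) := by gcongr
            _ = _ := by ring
        have h7 : |(gaussDeriv p).eval x| ≤ |p.derivative.eval x| + 6 * n * |p.eval x| := by
          simp only [gaussDeriv, Polynomial.eval_sub, Polynomial.eval_mul, Polynomial.eval_ofNat,
            Polynomial.eval_X]
          refine (abs_sub _ _).trans ?_
          rw [abs_mul, abs_mul, abs_two]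
          have : 2 * |x| * |p.eval x| ≤ 2 * (3 * n) * |p.eval x| := by gcongr
          linarith
        rw [abs_mul, abs_mul, abs_of_pos hw]
        have h8 := mul_le_mul_of_nonneg_right h7 hw.le
        nlinarith
    _ = 2 * (∫ x in -(3 * n)..3 * n, |g.derivative.eval x|) +
          24 * n * ∫ x in -(3 * n)..3 * n, |p.eval x * Real.exp (-x ^ 2)| := by
        rw [intervalIntegral.integral_add (Continuous.intervalIntegrable (by fun_prop) _ _)
          (Continuous.intervalIntegrable (by fun_prop) _ _),
          intervalIntegral.integral_const_mul, intervalIntegral.integral_const_mul]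
    _ ≤ 2 * (372 * n * (3 / 2 * I)) + 24 * n * I := by
        have : (8 * (g.natDegree : ℝ) + 12) / (6 * n) ≤ 372 * n := by
          rw [div_le_iff₀ (by linarith)]
          nlinarith
        gcongr
        refine hmain.trans ?_
        gcongr
        exact intervalIntegral.integral_nonneg (by linarith) fun x _ => abs_nonneg _
    _ ≤ _ := by nlinarith [mul_nonneg (by linarith : 0 ≤ n) hI0]

/-! ### Pointwise bounds, tails and the global Bernstein inequality -/

theorem integrable_pow_mul_exp {b : ℝ} (hb : 0 < b) (k : ℕ) :
    Integrable fun x : ℝ => x ^ k * Real.exp (-b * x ^ 2) := by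
  have h := integrable_rpow_mul_exp_neg_mul_sq hb (s := k)
    (lt_of_lt_of_le (by norm_num) (Nat.cast_nonneg k))
  simpa only [Real.rpow_natCast] using h

theorem integrable_eval_mul_gauss (p : Polynomial ℝ) :
    Integrable fun x : ℝ => p.eval x * Real.exp (-x ^ 2) := by
  have : (fun x : ℝ => p.eval x * Real.exp (-x ^ 2)) = fun x =>
      ∑ k ∈ Finset.range (p.natDegree + 1), p.coeff k * (x ^ k * Real.exp (-1 * x ^ 2)) := by
    funext x
    rw [Polynomial.eval_eq_sum_range, Finset.sum_mul]
    refine Finset.sum_congr rfl fun k _ => ?_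
    rw [neg_one_mul, mul_assoc]
  rw [this]
  exact integrable_finsetSum _ fun k _ => (integrable_pow_mul_exp one_pos k).const_mul _

theorem intervalIntegral_abs_le {f : ℝ → ℝ} (hf : Integrable f) {a b : ℝ} (hab : a ≤ b) :
    ∫ x in a..b, |f x| ≤ ∫ x, |f x| := by
  rw [intervalIntegral.integral_of_le hab]
  exact setIntegral_le_integral hf.abs (Filter.Eventually.of_forall fun x => abs_nonneg _)

/-- A value at x differs from the value at any y in [-n, n] by at most the L¹ norm of the derivative
on [-3n, 3n]; averaging over y gives the bound. -/
theorem abs_mul_gauss_le {n : ℝ} (hn : 1 ≤ n) (p : Polynomial ℝ) (hp : p.natDegree ≤ 3 * n ^ 2)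
    {x : ℝ} (hx : |x| ≤ n) :
    |p.eval x * Real.exp (-x ^ 2)| ≤ 1201 * n * ∫ x, |p.eval x * Real.exp (-x ^ 2)| := by
  set f : ℝ → ℝ := fun x => p.eval x * Real.exp (-x ^ 2) with hf
  set f' : ℝ → ℝ := fun x => (gaussDeriv p).eval x * Real.exp (-x ^ 2) with hf'
  have hc : Continuous f := continuous_mul_gauss p
  have hc' : Continuous f' := continuous_mul_gauss (gaussDeriv p)
  have hint := integrable_eval_mul_gauss p
  have hI0 : 0 ≤ ∫ x, |f x| := integral_nonneg fun x => abs_nonneg _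
  set I := ∫ x, |f x| with hI
  have hB : ∫ x in -(3 * n)..3 * n, |f' x| ≤ 1200 * n * I :=
    (local_bernstein hn p hp).trans (by
      gcongr
      exact intervalIntegral_abs_le hint (by linarith))
  have hx' := abs_le.1 hx
  have hpt : ∀ y ∈ Set.Icc (-n) n, |f x| ≤ |f y| + 1200 * n * I := by
    intro y hy
    have h1 : ∫ t in y..x, f' t = f x - f y :=
      intervalIntegral.integral_eq_sub_of_hasDerivAt (fun t _ => hasDerivAt_mul_gauss p t)
        (hc'.intervalIntegrable _ _)
    have h2 : |∫ t in y..x, f' t| ≤ ∫ x in -(3 * n)..3 * n, |f' x| := by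
      refine (intervalIntegral.norm_integral_le_integral_norm_uIoc (f := f')).trans ?_
      rw [intervalIntegral.integral_of_le (by linarith)]
      refine setIntegral_mono_set (hc'.abs.integrableOn_Ioc)
        (Filter.Eventually.of_forall fun x => abs_nonneg _) (Filter.Eventually.of_forall ?_)
      intro t ht
      change t ∈ Set.uIoc y x at ht
      change t ∈ Set.Ioc (-(3 * n)) (3 * n)
      rw [Set.mem_uIoc] at ht
      rcases ht with ht | ht <;> constructor <;> linarith [hy.1, hy.2, ht.1, ht.2]
    rw [h1] at h2
    have := abs_sub_abs_le_abs_sub (f x) (f y)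
    linarith
  have h3 : ∫ _ in -n..n, |f x| ≤ ∫ y in -n..n, (|f y| + 1200 * n * I) :=
    intervalIntegral.integral_mono_on (by linarith)
      (Continuous.intervalIntegrable (by fun_prop) _ _)
      (Continuous.intervalIntegrable (by fun_prop) _ _) hpt
  rw [intervalIntegral.integral_add (Continuous.intervalIntegrable (by fun_prop) _ _)
    (Continuous.intervalIntegrable (by fun_prop) _ _), intervalIntegral.integral_const,
    intervalIntegral.integral_const, smul_eq_mul, smul_eq_mul] at h3
  have h4 : ∫ y in -n..n, |f y| ≤ I := intervalIntegral_abs_le hint (by linarith)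
  have h5 : n * |f x| ≤ n * (1201 * n * I) := by nlinarith [mul_nonneg (by nlinarith : 0 ≤ n * n - 1) hI0]
  exact le_of_mul_le_mul_left h5 (by linarith)

/-- Growth of a polynomial outside an interval on which it is bounded. -/
theorem abs_eval_le_of_abs_le (p : Polynomial ℝ) {b B : ℝ} (hb : 0 < b) (hB : 0 < B)
    (h : ∀ x, |x| ≤ b → |p.eval x| ≤ B) {x : ℝ} (hx : b ≤ |x|) :
    |p.eval x| ≤ B * (2 * (|x| / b)) ^ p.natDegree := by
  have key : ∀ s σ : ℝ, |s| = 1 → |σ| = 1 → s * p.eval (σ * |x|) ≤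
      B * (2 * (|x| / b)) ^ p.natDegree := by
    intro s σ hs hσ
    have hy : 1 ≤ |x| / b := (one_le_div hb).2 hx
    set q : Polynomial ℝ := Polynomial.C (s / B) * p.comp (Polynomial.C (σ * b) * Polynomial.X)
      with hq
    have hqe : ∀ y, q.eval y = s / B * p.eval (σ * b * y) := fun y => by simp [hq]
    have hdeg : q.degree ≤ p.natDegree := by
      refine Polynomial.degree_le_of_natDegree_le ((Polynomial.natDegree_C_mul_le _ _).trans ?_)
      rw [Polynomial.natDegree_comp]
      calc _ ≤ p.natDegree * 1 := by
            gcongr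
            exact (Polynomial.natDegree_C_mul_le _ _).trans Polynomial.natDegree_X_le
        _ = _ := mul_one _
    have hbd : ∀ y ∈ Set.Icc (-1 : ℝ) 1, |q.eval y| ≤ 1 := by
      intro y hy
      rw [hqe, abs_mul, abs_div, hs, abs_of_pos hB, one_div, inv_mul_le_iff₀ hB, mul_one]
      apply h
      rw [abs_mul, abs_mul, hσ, abs_of_pos hb, one_mul]
      exact mul_le_of_le_one_right hb.le (abs_le.2 hy)
    have h1 := Polynomial.Chebyshev.eval_iterate_derivative_le_of_forall_abs_le_one (k := 0)
      hy hdeg hbd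
    simp only [Function.iterate_zero, id_eq] at h1
    -- With |x|/b = cosh u, the Chebyshev value is cosh(du) ≤ exp(d|u|) ≤ (2 cosh u)^d.
    have h2 : (Polynomial.Chebyshev.T ℝ p.natDegree).eval (|x| / b) ≤
        (2 * (|x| / b)) ^ p.natDegree := by
      obtain ⟨u, hu⟩ : ∃ u, Real.cosh u = |x| / b := ⟨_, Real.cosh_arcosh hy⟩
      rw [← hu, Polynomial.Chebyshev.T_real_cosh, ← Real.cosh_abs u]
      rw [← Real.cosh_abs, abs_mul]
      calc Real.cosh (|((p.natDegree : ℤ) : ℝ)| * |u|) ≤ Real.exp (p.natDegree * |u|) := by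
            rw [Real.cosh_eq]
            have h0 : 0 ≤ (p.natDegree : ℝ) * |u| := by positivity
            have : Real.exp (-(p.natDegree * |u|)) ≤ Real.exp (p.natDegree * |u|) :=
              Real.exp_le_exp.2 (by linarith)
            simp only [Int.cast_natCast, Nat.abs_cast]
            linarith
        _ = Real.exp |u| ^ p.natDegree := Real.exp_nat_mul _ _
        _ ≤ _ := by
            gcongr
            rw [Real.cosh_eq]
            linarith [Real.exp_pos (-|u|)]
    rw [hqe, show σ * b * (|x| / b) = σ * |x| by field_simp] at h1
    have h3 := h1.trans h2
    rw [div_mul_eq_mul_div, div_le_iff₀ hB] at h3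
    linarith
  obtain ⟨σ, hσ, hσx⟩ : ∃ σ : ℝ, |σ| = 1 ∧ σ * |x| = x := by
    rcases abs_choice x with h | h
    · exact ⟨1, by simp, by rw [h]; ring⟩
    · exact ⟨-1, by simp, by rw [h]; ring⟩
  rw [abs_le']
  constructor
  · have := key 1 σ (by simp) hσ
    rwa [hσx, one_mul] at this
  · have := key (-1) σ (by simp) hσ
    rwa [hσx, neg_one_mul] at this

theorem abs_mul_gauss_le_of_le {n : ℝ} (hn : 10 ≤ n) (p : Polynomial ℝ)
    (hp : p.natDegree ≤ 2 * n ^ 2 + 1) {x : ℝ} (hx : 3 * n ≤ |x|) :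
    |p.eval x * Real.exp (-x ^ 2)| ≤
      1201 / n * (∫ x, |p.eval x * Real.exp (-x ^ 2)|) * Real.exp (-(1 / 10) * x ^ 2) * (10 / 9) := by
  rcases eq_or_ne p 0 with rfl | hp0
  · simp
  set I := ∫ x, |p.eval x * Real.exp (-x ^ 2)| with hI
  have hIle : 0 ≤ I := integral_nonneg fun x => abs_nonneg _
  have hbd : ∀ y, |y| ≤ n → |p.eval y| ≤ Real.exp (n ^ 2) * (1201 * n * I) := by
    intro y hy
    have h1 := abs_mul_gauss_le (by linarith) p (by nlinarith) hy
    rw [abs_mul, abs_of_pos (Real.exp_pos _)] at h1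
    have h2 : |p.eval y| = Real.exp (y ^ 2) * (|p.eval y| * Real.exp (-y ^ 2)) := by
      rw [mul_comm, mul_assoc, ← Real.exp_add]; simp
    rw [h2]
    have h3 : y ^ 2 ≤ n ^ 2 := by
      rw [← sq_abs]; gcongr
    gcongr
  have hI0 : 0 < I := by
    rcases hIle.lt_or_eq with h | h
    · exact h
    exfalso
    apply hp0
    apply Polynomial.eq_zero_of_infinite_isRoot
    refine (Set.Icc_infinite (show -n < n by linarith)).mono fun y hy => ?_
    have := hbd y (abs_le.2 hy)
    rw [← h, mul_zero, mul_zero] at this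
    exact abs_nonpos_iff.1 this
  have hgrow := abs_eval_le_of_abs_le p (by linarith : 0 < n)
    (by positivity : 0 < Real.exp (n ^ 2) * (1201 * n * I)) hbd (x := x) (by linarith)
  set s := |x| / n with hs
  have hs3 : 3 ≤ s := (le_div_iff₀ (by linarith)).2 hx
  have hxs : x ^ 2 = s ^ 2 * n ^ 2 := by
    rw [← sq_abs, hs]; field_simp
  -- For s ≥ 3 this bounds the growth factor by about exp(2n²s²/3), which leaves a third of the
  -- Gaussian exponent s²n². That third, at least 3n², covers the initial exp(n²) and the decay
  -- still required.
  have h2s : 2 * s ≤ Real.exp (s ^ 2 / 3) := by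
    refine le_trans ?_ (Real.quadratic_le_exp_of_nonneg (by positivity))
    nlinarith
  have hpow : (2 * s) ^ p.natDegree ≤ Real.exp ((2 * n ^ 2 + 1) * (s ^ 2 / 3)) := by
    refine (pow_le_pow_left₀ (by positivity) h2s _).trans ?_
    rw [← Real.exp_nat_mul]
    gcongr
  rw [abs_mul, abs_of_pos (Real.exp_pos _)]
  have hn0 : 0 < n := by linarith
  have hdecay : n * Real.exp (-(9 / 10) * n ^ 2) ≤ 1 / n * (10 / 9) := by
    have h1 : 9 / 10 * n ^ 2 ≤ Real.exp (9 / 10 * n ^ 2) := by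
      linarith [Real.add_one_le_exp (9 / 10 * n ^ 2)]
    rw [neg_mul, Real.exp_neg, ← div_eq_mul_inv, div_le_iff₀ (Real.exp_pos _)]
    calc n = 1 / n * (10 / 9) * (9 / 10 * n ^ 2) := by field_simp
      _ ≤ _ := by gcongr
  calc |p.eval x| * Real.exp (-x ^ 2)
      ≤ (Real.exp (n ^ 2) * (1201 * n * I) * Real.exp ((2 * n ^ 2 + 1) * (s ^ 2 / 3))) *
          Real.exp (-x ^ 2) := by
        gcongr
        exact hgrow.trans (by gcongr)
    _ = 1201 * n * I * Real.exp (n ^ 2 + (2 * n ^ 2 + 1) * (s ^ 2 / 3) - x ^ 2) := by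
        rw [sub_eq_add_neg, Real.exp_add, Real.exp_add]; ring
    _ ≤ 1201 * n * I * Real.exp (-(9 / 10) * n ^ 2 + -(1 / 10) * x ^ 2) := by
        gcongr
        rw [hxs]
        have h9 : 9 ≤ s ^ 2 := by nlinarith
        have h100 : 100 ≤ n ^ 2 := by nlinarith
        nlinarith [mul_nonneg (sub_nonneg.2 h9) (by linarith : 0 ≤ n ^ 2),
          mul_nonneg (sub_nonneg.2 h100) (by linarith : 0 ≤ s ^ 2)]
    _ = 1201 * I * Real.exp (-(1 / 10) * x ^ 2) * (n * Real.exp (-(9 / 10) * n ^ 2)) := by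
        rw [Real.exp_add]; ring
    _ ≤ 1201 * I * Real.exp (-(1 / 10) * x ^ 2) * (1 / n * (10 / 9)) := by gcongr
    _ = _ := by ring

/-- Weighted polynomials live on `[-3n, 3n]`. -/
theorem integral_tail_le {n : ℝ} (hn : 10 ≤ n) (p : Polynomial ℝ)
    (hp : p.natDegree ≤ 2 * n ^ 2 + 1) :
    ∫ x in {x | 3 * n < |x|}, |p.eval x * Real.exp (-x ^ 2)| ≤
      8100 / n * ∫ x, |p.eval x * Real.exp (-x ^ 2)| := by
  have hn0 : 0 < n := by linarith
  set I := ∫ x, |p.eval x * Real.exp (-x ^ 2)| with hI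
  have hIle : 0 ≤ I := integral_nonneg fun x => abs_nonneg _
  have hS : MeasurableSet {x : ℝ | 3 * n < |x|} := measurableSet_lt measurable_const measurable_norm
  have hg : Integrable fun x : ℝ => 1201 / n * I * Real.exp (-(1 / 10) * x ^ 2) * (10 / 9) :=
    ((integrable_exp_neg_mul_sq (by norm_num : (0 : ℝ) < 1 / 10)).const_mul _).mul_const _
  calc ∫ x in {x | 3 * n < |x|}, |p.eval x * Real.exp (-x ^ 2)|
      ≤ ∫ x in {x : ℝ | 3 * n < |x|},
          1201 / n * I * Real.exp (-(1 / 10) * x ^ 2) * (10 / 9) :=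
        setIntegral_mono_on (integrable_eval_mul_gauss p).abs.integrableOn hg.integrableOn hS
          fun x hx => abs_mul_gauss_le_of_le hn p hp (le_of_lt hx)
    _ ≤ ∫ x : ℝ, 1201 / n * I * Real.exp (-(1 / 10) * x ^ 2) * (10 / 9) :=
        setIntegral_le_integral hg (Filter.Eventually.of_forall fun x => by
          simp only [Pi.zero_apply]; positivity)
    _ = 1201 / n * I * √(Real.pi / (1 / 10)) * (10 / 9) := by
        rw [integral_mul_const, integral_const_mul, integral_gaussian]
    _ ≤ 1201 / n * I * 6 * (10 / 9) := by
        gcongr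
        rw [Real.sqrt_le_left (by norm_num)]
        linarith [Real.pi_lt_d2]
    _ ≤ _ := by
        have : 0 ≤ I / n := by positivity
        rw [show 1201 / n * I * 6 * (10 / 9) = 1201 * 6 * (10 / 9) * (I / n) by ring,
          show 8100 / n * I = 8100 * (I / n) by ring]
        gcongr
        norm_num

/-- The `L¹` Bernstein inequality for `p * exp (-x²)`. -/
theorem global_bernstein {n : ℝ} (hn : 16200 ≤ n) (p : Polynomial ℝ)
    (hp : p.natDegree ≤ 2 * n ^ 2) :
    ∫ x, |(gaussDeriv p).eval x * Real.exp (-x ^ 2)| ≤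
      2400 * n * ∫ x, |p.eval x * Real.exp (-x ^ 2)| := by
  have hn0 : 0 < n := by linarith
  have hint := integrable_eval_mul_gauss (gaussDeriv p)
  have hdeg : ((gaussDeriv p).natDegree : ℝ) ≤ 2 * n ^ 2 + 1 := by
    have : ((gaussDeriv p).natDegree : ℝ) ≤ p.natDegree + 1 := by
      exact_mod_cast natDegree_gaussDeriv_le p
    linarith
  have h1 := integral_tail_le (by linarith) (gaussDeriv p) hdeg
  have h2 := (local_bernstein (by linarith) p (by nlinarith)).trans
    (mul_le_mul_of_nonneg_left (intervalIntegral_abs_le (integrable_eval_mul_gauss p)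
      (by linarith : -(6 * n) ≤ 6 * n)) (by positivity))
  have hS : MeasurableSet {x : ℝ | 3 * n < |x|} := measurableSet_lt measurable_const measurable_norm
  have h3 := integral_add_compl hS hint.abs
  have h4 : {x : ℝ | 3 * n < |x|}ᶜ = Set.Icc (-(3 * n)) (3 * n) := by
    ext x; simp [abs_le]
  rw [h4, integral_Icc_eq_integral_Ioc, ← intervalIntegral.integral_of_le (by linarith)] at h3
  set J := ∫ x, |(gaussDeriv p).eval x * Real.exp (-x ^ 2)| with hJ
  have hJ0 : 0 ≤ J := integral_nonneg fun x => abs_nonneg _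
  -- The tail of the derivative is at most half of its own norm and is absorbed on the left,
  -- doubling the local constant 1200; this fixes 16200 = 2 · 8100.
  have h5 : 8100 / n * J ≤ 1 / 2 * J := by
    refine mul_le_mul_of_nonneg_right ?_ hJ0
    rw [div_le_iff₀ hn0]; linarith
  linarith

/-! ### Rescaling to exp(-A²x²), with integrals in `ENNReal` for later use of Tonelli -/

/-- The polynomial factor of the derivative of `p * exp (-A² x²)`. -/
noncomputable def scaledDeriv (A : ℝ) (p : Polynomial ℝ) : Polynomial ℝ :=
  p.derivative - Polynomial.C (2 * A ^ 2) * Polynomial.X * p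

theorem hasDerivAt_mul_scaled (A : ℝ) (p : Polynomial ℝ) (x : ℝ) :
    HasDerivAt (fun x => p.eval x * Real.exp (-(A ^ 2 * x ^ 2)))
      ((scaledDeriv A p).eval x * Real.exp (-(A ^ 2 * x ^ 2))) x := by
  have h1 : HasDerivAt (fun x : ℝ => -(A ^ 2 * x ^ 2)) (-(A ^ 2 * (2 * x))) x := by
    simpa using ((hasDerivAt_pow 2 x).const_mul (A ^ 2)).fun_neg
  refine ((p.hasDerivAt x).mul h1.exp).congr_deriv ?_
  simp only [scaledDeriv, Polynomial.eval_sub, Polynomial.eval_mul, Polynomial.eval_C,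
    Polynomial.eval_X]
  ring

/-- The rescaled polynomial `x ↦ p (x / A)`. -/
noncomputable def rescale (A : ℝ) (p : Polynomial ℝ) : Polynomial ℝ :=
  p.comp (Polynomial.C A⁻¹ * Polynomial.X)

theorem natDegree_rescale_le (A : ℝ) (p : Polynomial ℝ) :
    (rescale A p).natDegree ≤ p.natDegree := by
  rw [rescale, Polynomial.natDegree_comp]
  calc _ ≤ p.natDegree * 1 := by
        gcongr
        exact (Polynomial.natDegree_C_mul_le _ _).trans Polynomial.natDegree_X_le
    _ = _ := mul_one _

theorem mul_scaled_eq {A : ℝ} (hA : 0 < A) (p : Polynomial ℝ) (x : ℝ) :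
    p.eval x * Real.exp (-(A ^ 2 * x ^ 2)) =
      (rescale A p).eval (A * x) * Real.exp (-(A * x) ^ 2) := by
  simp [rescale, mul_pow, hA.ne']

theorem scaledDeriv_mul_eq {A : ℝ} (hA : 0 < A) (p : Polynomial ℝ) (x : ℝ) :
    (scaledDeriv A p).eval x * Real.exp (-(A ^ 2 * x ^ 2)) =
      A * ((gaussDeriv (rescale A p)).eval (A * x) * Real.exp (-(A * x) ^ 2)) := by
  simp only [scaledDeriv, gaussDeriv, rescale, Polynomial.derivative_comp, Polynomial.eval_sub,
    Polynomial.eval_mul, Polynomial.eval_C, Polynomial.eval_X, Polynomial.eval_comp,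
    Polynomial.derivative_C_mul, Polynomial.derivative_X, Polynomial.eval_one,
    Polynomial.eval_ofNat, inv_mul_cancel_left₀ hA.ne', mul_pow]
  field_simp

theorem integrable_mul_scaled {A : ℝ} (hA : 0 < A) (p : Polynomial ℝ) :
    Integrable fun x => p.eval x * Real.exp (-(A ^ 2 * x ^ 2)) := by
  simp only [mul_scaled_eq hA]
  exact (integrable_eval_mul_gauss (rescale A p)).comp_mul_left' hA.ne'

theorem lintegral_scaledDeriv_le {A n : ℝ} (hA : 0 < A) (hn : 16200 ≤ n) (p : Polynomial ℝ)
    (hp : p.natDegree ≤ 2 * n ^ 2) :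
    ∫⁻ x, ‖(scaledDeriv A p).eval x * Real.exp (-(A ^ 2 * x ^ 2))‖ₑ ≤
      ENNReal.ofReal (2400 * n * A) * ∫⁻ x, ‖p.eval x * Real.exp (-(A ^ 2 * x ^ 2))‖ₑ := by
  have hn0 : 0 < n := by linarith
  rw [← ofReal_integral_norm_eq_lintegral_enorm (integrable_mul_scaled hA p),
    ← ofReal_integral_norm_eq_lintegral_enorm (integrable_mul_scaled hA (scaledDeriv A p)),
    ← ENNReal.ofReal_mul (by positivity)]
  apply ENNReal.ofReal_le_ofReal
  simp only [scaledDeriv_mul_eq hA, mul_scaled_eq hA p, norm_mul, Real.norm_eq_abs]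
  simp only [← abs_mul]
  rw [Measure.integral_comp_mul_left
      (fun u => |A * ((gaussDeriv (rescale A p)).eval u * Real.exp (-u ^ 2))|),
    Measure.integral_comp_mul_left (fun u => |(rescale A p).eval u * Real.exp (-u ^ 2)|)]
  simp only [abs_mul A, integral_const_mul, smul_eq_mul, abs_of_pos hA, abs_of_pos (inv_pos.2 hA)]
  have h := global_bernstein hn (rescale A p)
    (le_trans (by exact_mod_cast natDegree_rescale_le A p) hp)
  rw [inv_mul_cancel_left₀ hA.ne']
  refine h.trans (le_of_eq ?_)
  field_simp

theorem lintegral_scaled_tail_le {A n : ℝ} (hA : 0 < A) (hn : 10 ≤ n) (p : Polynomial ℝ)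
    (hp : p.natDegree ≤ 2 * n ^ 2) :
    ∫⁻ x in {x | 3 * n / A < |x|}, ‖p.eval x * Real.exp (-(A ^ 2 * x ^ 2))‖ₑ ≤
      ENNReal.ofReal (8100 / n) * ∫⁻ x, ‖p.eval x * Real.exp (-(A ^ 2 * x ^ 2))‖ₑ := by
  have hn0 : 0 < n := by linarith
  have hS : ∀ b : ℝ, MeasurableSet {x : ℝ | b < |x|} :=
    fun b => measurableSet_lt measurable_const measurable_norm
  rw [← ofReal_integral_norm_eq_lintegral_enorm (integrable_mul_scaled hA p),
    ← ofReal_integral_norm_eq_lintegral_enorm (integrable_mul_scaled hA p).integrableOn,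
    ← ENNReal.ofReal_mul (by positivity)]
  apply ENNReal.ofReal_le_ofReal
  rw [← integral_indicator (hS _)]
  have hind : ({x : ℝ | 3 * n / A < |x|}.indicator
      fun x => ‖p.eval x * Real.exp (-(A ^ 2 * x ^ 2))‖) = fun x =>
      ({x : ℝ | 3 * n < |x|}.indicator
        fun u => |(rescale A p).eval u * Real.exp (-u ^ 2)|) (A * x) := by
    funext x
    have : 3 * n / A < |x| ↔ 3 * n < |A * x| := by
      rw [div_lt_iff₀ hA, abs_mul, abs_of_pos hA, mul_comm A]
    simp only [Set.indicator, Set.mem_ofPred_eq, this, mul_scaled_eq hA p, Real.norm_eq_abs]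
  rw [hind]
  simp only [mul_scaled_eq hA p, Real.norm_eq_abs]
  rw [Measure.integral_comp_mul_left
      ({x : ℝ | 3 * n < |x|}.indicator fun u => |(rescale A p).eval u * Real.exp (-u ^ 2)|),
    Measure.integral_comp_mul_left (fun u => |(rescale A p).eval u * Real.exp (-u ^ 2)|),
    integral_indicator (hS _)]
  have h := integral_tail_le hn (rescale A p) (by
    have : ((rescale A p).natDegree : ℝ) ≤ p.natDegree := by
      exact_mod_cast natDegree_rescale_le A p
    linarith)
  simp only [smul_eq_mul]
  calc _ ≤ |A⁻¹| * (8100 / n * ∫ x, |(rescale A p).eval x * Real.exp (-x ^ 2)|) := by gcongr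
    _ = _ := by ring

/-! ### Several variables: restriction to coordinate lines -/

variable {q : ℕ}

/-- The univariate polynomial obtained by fixing all coordinates of `x` but the `i`-th. -/
noncomputable def slice (x : Fin q → ℝ) (i : Fin q) :
    MvPolynomial (Fin q) ℝ →ₐ[ℝ] Polynomial ℝ :=
  MvPolynomial.aeval fun j => if j = i then Polynomial.X else Polynomial.C (x j)

theorem eval_slice (x : Fin q → ℝ) (i : Fin q) (P : MvPolynomial (Fin q) ℝ) (t : ℝ) :
    (slice x i P).eval t = MvPolynomial.eval (Function.update x i t) P := by
  induction P using MvPolynomial.induction_on with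
  | C a => simp [slice]
  | add p r hp hr => simp [hp, hr]
  | mul_X p j hp =>
    rw [map_mul, Polynomial.eval_mul, hp, map_mul]
    congr 1
    by_cases h : j = i
    · subst h; simp [slice]
    · simp [slice, h]

theorem derivative_slice (x : Fin q → ℝ) (i : Fin q) (P : MvPolynomial (Fin q) ℝ) :
    (slice x i P).derivative = slice x i (MvPolynomial.pderiv i P) := by
  induction P using MvPolynomial.induction_on with
  | C a => simp [slice]
  | add p r hp hr => simp [hp, hr]
  | mul_X p j hp =>
    rw [map_mul, Polynomial.derivative_mul, hp, Derivation.leibniz, map_add, smul_eq_mul,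
      smul_eq_mul, map_mul, map_mul, add_comm, mul_comm (slice x i (MvPolynomial.pderiv i p))]
    congr 2
    by_cases h : j = i
    · subst h; simp [slice]
    · simp [slice, h, MvPolynomial.pderiv_X_of_ne h]

theorem natDegree_slice_le (x : Fin q → ℝ) (i : Fin q) (P : MvPolynomial (Fin q) ℝ) :
    (slice x i P).natDegree ≤ P.degreeOf i := by
  rw [slice, MvPolynomial.aeval_def, MvPolynomial.eval₂_eq']
  refine Polynomial.natDegree_sum_le_of_forall_le _ _ fun m hm => ?_
  refine (Polynomial.natDegree_C_mul_le _ _).trans ?_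
  refine (Polynomial.natDegree_prod_le _ _).trans ?_
  calc ∑ j, ((if j = i then Polynomial.X else Polynomial.C (x j) : Polynomial ℝ) ^ m j).natDegree
      ≤ ∑ j, if j = i then m i else 0 := by
        refine Finset.sum_le_sum fun j _ => ?_
        split_ifs with h
        · subst h; simp
        · rw [← Polynomial.C_pow, Polynomial.natDegree_C]
    _ = m i := by simp
    _ ≤ P.degreeOf i := MvPolynomial.monomial_le_degreeOf i hm

theorem degreeOf_pderiv_le (i j : Fin q) (P : MvPolynomial (Fin q) ℝ) :
    (MvPolynomial.pderiv i P).degreeOf j ≤ P.degreeOf j := by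
  conv_lhs => rw [P.as_sum, map_sum]
  refine (MvPolynomial.degreeOf_sum_le _ _ _).trans (Finset.sup_le fun m hm => ?_)
  rw [MvPolynomial.pderiv_monomial, MvPolynomial.degreeOf_le_iff]
  intro m' hm'
  rw [Finset.mem_singleton.1 (MvPolynomial.support_monomial_subset hm')]
  refine le_trans ?_ (MvPolynomial.monomial_le_degreeOf j hm)
  simp

/-- The weighted polynomial `P(x) exp (-A² |x|²)`. -/
noncomputable def weighted (A : ℝ) (P : MvPolynomial (Fin q) ℝ) (x : Fin q → ℝ) : ℝ :=
  MvPolynomial.eval x P * gauss A x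

/-- The polynomial factor of the `i`-th partial derivative of a weighted polynomial. -/
noncomputable def weightedDeriv (A : ℝ) (i : Fin q) (P : MvPolynomial (Fin q) ℝ) :
    MvPolynomial (Fin q) ℝ :=
  MvPolynomial.pderiv i P - MvPolynomial.C (2 * A ^ 2) * (P * MvPolynomial.X i)

/-- Only the degree in the differentiated variable can grow. Mixed derivatives using each variable
once therefore satisfy the original degree bound in every variable still to be differentiated. -/
theorem degreeOf_weightedDeriv_le (A : ℝ) {i j : Fin q} (h : j ≠ i)
    (P : MvPolynomial (Fin q) ℝ) : (weightedDeriv A i P).degreeOf j ≤ P.degreeOf j := by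
  refine (MvPolynomial.degreeOf_sub_le _ _ _).trans (max_le (degreeOf_pderiv_le i j P) ?_)
  refine (MvPolynomial.degreeOf_C_mul_le _ _ _).trans ?_
  rw [MvPolynomial.degreeOf_mul_X_of_ne _ h]

theorem slice_weightedDeriv (A : ℝ) (x : Fin q → ℝ) (i : Fin q) (P : MvPolynomial (Fin q) ℝ) :
    slice x i (weightedDeriv A i P) = scaledDeriv A (slice x i P) := by
  have h1 : slice x i (MvPolynomial.X i) = Polynomial.X := by simp [slice]
  have h2 : slice x i (MvPolynomial.C (2 * A ^ 2)) = Polynomial.C (2 * A ^ 2) := by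
    simp only [slice, MvPolynomial.aeval_C]; rfl
  rw [weightedDeriv, scaledDeriv, derivative_slice, map_sub, map_mul (slice x i),
    map_mul (slice x i), h1, h2]
  ring

/-- The Gaussian factor coming from the coordinates other than `i`. -/
noncomputable def gaussRest (A : ℝ) (x : Fin q → ℝ) (i : Fin q) : ℝ :=
  Real.exp (-(A ^ 2 * ∑ j ∈ Finset.univ.erase i, x j ^ 2))

theorem weighted_update (A : ℝ) (P : MvPolynomial (Fin q) ℝ) (x : Fin q → ℝ) (i : Fin q) (t : ℝ) :
    weighted A P (Function.update x i t) =
      (slice x i P).eval t * Real.exp (-(A ^ 2 * t ^ 2)) * gaussRest A x i := by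
  rw [weighted, eval_slice, mul_assoc, gauss, gaussRest, ← Real.exp_add]
  congr 2
  rw [← Finset.add_sum_erase _ _ (Finset.mem_univ i)]
  have : ∑ j ∈ Finset.univ.erase i, Function.update x i t j ^ 2 =
      ∑ j ∈ Finset.univ.erase i, x j ^ 2 :=
    Finset.sum_congr rfl fun j hj => by rw [Function.update_of_ne (Finset.ne_of_mem_erase hj)]
  rw [this, Function.update_self]
  ring

theorem continuous_weighted (A : ℝ) (P : MvPolynomial (Fin q) ℝ) : Continuous (weighted A P) := by
  have := MvPolynomial.continuous_eval P
  unfold weighted gauss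
  fun_prop

theorem hasDerivAt_weighted_update (A : ℝ) (P : MvPolynomial (Fin q) ℝ) (x : Fin q → ℝ)
    (i : Fin q) (t : ℝ) :
    HasDerivAt (fun t => weighted A P (Function.update x i t))
      (weighted A (weightedDeriv A i P) (Function.update x i t)) t := by
  simp only [weighted_update, slice_weightedDeriv]
  exact (hasDerivAt_mul_scaled A (slice x i P) t).mul_const _

theorem integrable_weighted {A : ℝ} (hA : 0 < A) (P : MvPolynomial (Fin q) ℝ) :
    Integrable (weighted A P) := by
  have : weighted A P = fun x => ∑ m ∈ P.support,
      P.coeff m * ∏ i, (x i ^ m i * Real.exp (-A ^ 2 * x i ^ 2)) := by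
    funext x
    rw [weighted, MvPolynomial.eval_eq', Finset.sum_mul]
    refine Finset.sum_congr rfl fun m _ => ?_
    rw [Finset.prod_mul_distrib, ← Real.exp_sum, gauss, mul_assoc, ← Finset.mul_sum, neg_mul]
  rw [this]
  refine integrable_finsetSum _ fun m _ => Integrable.const_mul ?_ _
  exact Integrable.fintype_prod (f := fun i t => t ^ m i * Real.exp (-A ^ 2 * t ^ 2))
    fun i => integrable_pow_mul_exp (by positivity) (m i)

/-- An inequality between integrals along all lines in a coordinate direction may be integrated. -/
theorem lintegral_le_mul_of_update (i : Fin q) {f g : (Fin q → ℝ) → ENNReal} (hf : Measurable f)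
    (hg : Measurable g) (c : ENNReal)
    (h : ∀ x, ∫⁻ t, f (Function.update x i t) ≤ c * ∫⁻ t, g (Function.update x i t)) :
    ∫⁻ x, f x ≤ c * ∫⁻ x, g x := by
  rw [← lintegral_const_mul _ hg]
  refine lintegral_le_of_lmarginal_le (μ := fun _ => volume) {i} hf (hg.const_mul c) ?_
  rw [lmarginal_singleton, lmarginal_singleton]
  intro x
  exact (h x).trans (lintegral_const_mul c (hg.comp (measurable_update x))).symm.le

theorem lintegral_weightedDeriv_le {A n : ℝ} (hA : 0 < A) (hn : 16200 ≤ n)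
    (P : MvPolynomial (Fin q) ℝ) {i : Fin q} (hP : P.degreeOf i ≤ 2 * n ^ 2) :
    ∫⁻ x, ‖weighted A (weightedDeriv A i P) x‖ₑ ≤
      ENNReal.ofReal (2400 * n * A) * ∫⁻ x, ‖weighted A P x‖ₑ := by
  refine lintegral_le_mul_of_update i (continuous_weighted A _).measurable.enorm
    (continuous_weighted A _).measurable.enorm _ fun x => ?_
  simp only [weighted_update, slice_weightedDeriv, enorm_mul _ (gaussRest A x i)]
  rw [lintegral_mul_const' _ _ enorm_ne_top, lintegral_mul_const' _ _ enorm_ne_top, ← mul_assoc]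
  gcongr
  exact lintegral_scaledDeriv_le hA hn (slice x i P)
    (le_trans (by exact_mod_cast natDegree_slice_le x i P) hP)

theorem lintegral_weighted_tail_le {A n : ℝ} (hA : 0 < A) (hn : 10 ≤ n)
    (P : MvPolynomial (Fin q) ℝ) {i : Fin q} (hP : P.degreeOf i ≤ 2 * n ^ 2) :
    ∫⁻ x in {x | 3 * n / A < |x i|}, ‖weighted A P x‖ₑ ≤
      ENNReal.ofReal (8100 / n) * ∫⁻ x, ‖weighted A P x‖ₑ := by
  have hm : Measurable fun x => ‖weighted A P x‖ₑ := (continuous_weighted A _).measurable.enorm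
  have hS : MeasurableSet {x : Fin q → ℝ | 3 * n / A < |x i|} :=
    measurableSet_lt measurable_const (measurable_pi_apply i).norm
  have hS1 : MeasurableSet {t : ℝ | 3 * n / A < |t|} :=
    measurableSet_lt measurable_const measurable_norm
  rw [← lintegral_indicator hS]
  refine lintegral_le_mul_of_update i (hm.indicator hS) hm _ fun x => ?_
  have : ∀ t, {x : Fin q → ℝ | 3 * n / A < |x i|}.indicator (fun x => ‖weighted A P x‖ₑ)
      (Function.update x i t) = {t : ℝ | 3 * n / A < |t|}.indicator
        (fun t => ‖weighted A P (Function.update x i t)‖ₑ) t := by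
    intro t
    simp [Set.indicator]
  simp only [this]
  rw [lintegral_indicator hS1]
  simp only [weighted_update, enorm_mul _ (gaussRest A x i)]
  rw [lintegral_mul_const' _ _ enorm_ne_top, lintegral_mul_const' _ _ enorm_ne_top, ← mul_assoc]
  gcongr
  exact lintegral_scaled_tail_le hA hn (slice x i P)
    (le_trans (by exact_mod_cast natDegree_slice_le x i P) hP)

/-! ### Mean oscillation at scale δ -/

/-- A majorant of the oscillation of a weighted polynomial over displacements of size at most `δ`
in the coordinates listed. -/
noncomputable def localVar (A δ : ℝ) :
    List (Fin q) → MvPolynomial (Fin q) ℝ → (Fin q → ℝ) → ENNReal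
  | [], _, _ => 0
  | i :: l, P, x => localVar A δ l P x + ∫⁻ s in Set.Icc (-δ) δ,
      (‖weighted A (weightedDeriv A i P) (x + Pi.single i s)‖ₑ +
        localVar A δ l (weightedDeriv A i P) (x + Pi.single i s))

theorem measurable_add_single (i : Fin q) :
    Measurable fun z : (Fin q → ℝ) × ℝ => z.1 + (Pi.single i z.2 : Fin q → ℝ) := by
  refine measurable_pi_iff.2 fun j => ?_
  by_cases h : j = i
  · subst h
    simp only [Pi.add_apply, Pi.single_eq_same]
    fun_prop
  · simp only [Pi.add_apply, Pi.single_eq_of_ne h, add_zero]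
    fun_prop

theorem measurable_localVar (A δ : ℝ) (l : List (Fin q)) (P : MvPolynomial (Fin q) ℝ) :
    Measurable (localVar A δ l P) := by
  induction l generalizing P with
  | nil => exact measurable_const
  | cons i l ih =>
    refine (ih P).add ?_
    have hadd := measurable_add_single i
    exact Measurable.lintegral_prod_right'
      (f := fun z : (Fin q → ℝ) × ℝ =>
        ‖weighted A (weightedDeriv A i P) (z.1 + (Pi.single i z.2 : Fin q → ℝ))‖ₑ +
          localVar A δ l (weightedDeriv A i P) (z.1 + (Pi.single i z.2 : Fin q → ℝ)))
      (((continuous_weighted A _).measurable.enorm.comp hadd).add ((ih _).comp hadd))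

theorem enorm_weighted_sub_le_localVar (A δ : ℝ) (l : List (Fin q)) (P : MvPolynomial (Fin q) ℝ)
    {x y : Fin q → ℝ} (h : ∀ j ∈ l, |y j - x j| ≤ δ) (h' : ∀ j ∉ l, y j = x j) :
    ‖weighted A P y - weighted A P x‖ₑ ≤ localVar A δ l P x := by
  induction l generalizing P x y with
  | nil =>
    have : y = x := funext fun j => h' j (by simp)
    simp [this]
  | cons i l ih =>
    have hi : |y i - x i| ≤ δ := h i (by simp)
    have hδ : 0 ≤ δ := (abs_nonneg _).trans hi
    -- The path from x to y moves coordinate i last. On that segment the derivative is evaluated off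
    -- the line through x, and the induction hypothesis for the derivative brings it back to `x +
    -- Pi.single i s`.
    set z := Function.update y i (x i) with hz
    have hzx : ‖weighted A P z - weighted A P x‖ₑ ≤ localVar A δ l P x := by
      refine ih P (fun j hj => ?_) fun j hj => ?_
      · by_cases hji : j = i
        · subst hji; simpa [hz] using hδ
        · rw [hz, Function.update_of_ne hji]; exact h j (by simp [hj])
      · by_cases hji : j = i
        · subst hji; simp [hz]
        · rw [hz, Function.update_of_ne hji]; exact h' j (by simp [hj, hji])
    have hD : ∀ s, HasDerivAt (fun s => weighted A P (Function.update y i (x i + s)))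
        (weighted A (weightedDeriv A i P) (Function.update y i (x i + s))) s := fun s =>
      (hasDerivAt_weighted_update A P y i (x i + s)).comp_const_add (x i) s
    have hcont : Continuous fun s =>
        weighted A (weightedDeriv A i P) (Function.update y i (x i + s)) :=
      (continuous_weighted A _).comp (continuous_const.update i (by fun_prop))
    have hftc : ∫ s in (0 : ℝ)..(y i - x i),
        weighted A (weightedDeriv A i P) (Function.update y i (x i + s)) =
        weighted A P y - weighted A P z := by
      rw [intervalIntegral.integral_eq_sub_of_hasDerivAt (fun s _ => hD s)
        (hcont.intervalIntegrable _ _)]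
      simp [hz]
    have hpt : ∀ s ∈ Set.Icc (-δ) δ,
        ‖weighted A (weightedDeriv A i P) (Function.update y i (x i + s))‖ₑ ≤
          ‖weighted A (weightedDeriv A i P) (x + Pi.single i s)‖ₑ +
            localVar A δ l (weightedDeriv A i P) (x + Pi.single i s) := by
      intro s _
      have := ih (weightedDeriv A i P) (x := x + Pi.single i s)
        (y := Function.update y i (x i + s)) (fun j hj => ?_) fun j hj => ?_
      · calc _ = ‖weighted A (weightedDeriv A i P) (x + Pi.single i s) +
              (weighted A (weightedDeriv A i P) (Function.update y i (x i + s)) -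
                weighted A (weightedDeriv A i P) (x + Pi.single i s))‖ₑ := by
              rw [add_sub_cancel]
          _ ≤ _ := (enorm_add_le _ _).trans (by gcongr)
      · by_cases hji : j = i
        · subst hji; simpa using hδ
        · simpa [hji] using h j (by simp [hj])
      · by_cases hji : j = i
        · subst hji; simp
        · simpa [hji] using h' j (by simp [hj, hji])
    have hyz : ‖weighted A P y - weighted A P z‖ₑ ≤ ∫⁻ s in Set.Icc (-δ) δ,
        (‖weighted A (weightedDeriv A i P) (x + Pi.single i s)‖ₑ +
          localVar A δ l (weightedDeriv A i P) (x + Pi.single i s)) := by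
      rw [← hftc]
      have hsub : Set.uIoc 0 (y i - x i) ⊆ Set.Icc (-δ) δ := by
        intro s hs
        rw [Set.mem_uIoc] at hs
        have := abs_le.1 hi
        rcases hs with hs | hs <;> constructor <;> linarith [hs.1, hs.2]
      calc _ = ‖∫ s in Set.uIoc 0 (y i - x i),
            weighted A (weightedDeriv A i P) (Function.update y i (x i + s))‖ₑ := by
            rw [← ofReal_norm, ← ofReal_norm,
              intervalIntegral.norm_intervalIntegral_eq]
        _ ≤ ∫⁻ s in Set.uIoc 0 (y i - x i),
            ‖weighted A (weightedDeriv A i P) (Function.update y i (x i + s))‖ₑ :=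
            enorm_integral_le_lintegral_enorm _
        _ ≤ ∫⁻ s in Set.Icc (-δ) δ,
            ‖weighted A (weightedDeriv A i P) (Function.update y i (x i + s))‖ₑ :=
            lintegral_mono_set hsub
        _ ≤ _ := setLIntegral_mono' measurableSet_Icc hpt
    calc ‖weighted A P y - weighted A P x‖ₑ
        = ‖(weighted A P z - weighted A P x) + (weighted A P y - weighted A P z)‖ₑ := by
          congr 1; ring
      _ ≤ _ := (enorm_add_le _ _).trans (add_le_add hzx hyz)

theorem lintegral_lintegral_add_single {G : (Fin q → ℝ) → ENNReal} (hG : Measurable G)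
    (i : Fin q) (δ : ℝ) :
    ∫⁻ x : Fin q → ℝ, ∫⁻ s in Set.Icc (-δ) δ, G (x + Pi.single i s) =
      ENNReal.ofReal (2 * δ) * ∫⁻ x, G x := by
  have hm : Measurable (Function.uncurry fun (x : Fin q → ℝ) (s : ℝ) =>
      G (x + (Pi.single i s : Fin q → ℝ))) := hG.comp (measurable_add_single i)
  rw [lintegral_lintegral_swap hm.aemeasurable]
  simp only [lintegral_add_right_eq_self]
  rw [setLIntegral_const, Real.volume_Icc, show δ - -δ = 2 * δ by ring, mul_comm]

/-- Translation invariance turns each inner integral into a factor 2δ, and Bernstein bounds each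
derivative by B = 2400nA. The recursion d ↦ d + 2δB(1 + d) makes 1 + d a power of 1 + 2δB. Distinct
coordinates are needed to keep the degree bounds. -/
theorem lintegral_localVar_le {A n δ : ℝ} (hA : 0 < A) (hn : 16200 ≤ n) (hδ : 0 ≤ δ)
    (l : List (Fin q)) (hl : l.Nodup) (P : MvPolynomial (Fin q) ℝ)
    (hP : ∀ i ∈ l, P.degreeOf i ≤ 2 * n ^ 2) :
    ∫⁻ x, localVar A δ l P x ≤
      ENNReal.ofReal ((1 + 2 * δ * (2400 * n * A)) ^ l.length - 1) * ∫⁻ x, ‖weighted A P x‖ₑ := by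
  have hB : 0 ≤ 2400 * n * A := by have : 0 < n := by linarith
                                   positivity
  set B := 2400 * n * A with hBdef
  induction l generalizing P with
  | nil => simp [localVar]
  | cons i l ih =>
    rw [List.nodup_cons] at hl
    have hd : 0 ≤ (1 + 2 * δ * B) ^ l.length - 1 :=
      sub_nonneg.2 (one_le_pow₀ (by nlinarith [mul_nonneg hδ hB]))
    set d := (1 + 2 * δ * B) ^ l.length - 1 with hddef
    have h1 := ih hl.2 P fun j hj => hP j (by simp [hj])
    have h2 := ih hl.2 (weightedDeriv A i P) fun j hj => by
      have hji : j ≠ i := fun h => hl.1 (h ▸ hj)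
      exact le_trans (by exact_mod_cast degreeOf_weightedDeriv_le A hji P) (hP j (by simp [hj]))
    have h3 := lintegral_weightedDeriv_le hA hn P (hP i (by simp))
    set N := ∫⁻ x, ‖weighted A P x‖ₑ
    set N' := ∫⁻ x, ‖weighted A (weightedDeriv A i P) x‖ₑ with hN'
    have hmeas : Measurable fun x => ‖weighted A (weightedDeriv A i P) x‖ₑ +
        localVar A δ l (weightedDeriv A i P) x :=
      (continuous_weighted A _).measurable.enorm.add (measurable_localVar A δ l _)
    have h4 : ∫⁻ x : Fin q → ℝ, ∫⁻ s in Set.Icc (-δ) δ,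
        (‖weighted A (weightedDeriv A i P) (x + Pi.single i s)‖ₑ +
          localVar A δ l (weightedDeriv A i P) (x + Pi.single i s)) ≤
        ENNReal.ofReal (2 * δ * (1 + d)) * N' := by
      rw [lintegral_lintegral_add_single (G := fun x => ‖weighted A (weightedDeriv A i P) x‖ₑ +
          localVar A δ l (weightedDeriv A i P) x) hmeas i δ,
        lintegral_add_left (continuous_weighted A _).measurable.enorm,
        ENNReal.ofReal_mul (p := 2 * δ) (by positivity), ENNReal.ofReal_add zero_le_one hd,
        ENNReal.ofReal_one, mul_assoc, add_mul, one_mul]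
      gcongr
    simp only [localVar]
    rw [lintegral_add_left (measurable_localVar A δ l P)]
    calc _ ≤ ENNReal.ofReal d * N + ENNReal.ofReal (2 * δ * (1 + d)) * (ENNReal.ofReal B * N) :=
          add_le_add h1 (h4.trans (by gcongr))
      _ = ENNReal.ofReal (d + 2 * δ * (1 + d) * B) * N := by
          rw [← mul_assoc, ← ENNReal.ofReal_mul (by positivity), ← add_mul,
            ← ENNReal.ofReal_add hd (by positivity)]
      _ = _ := by
          congr 2
          rw [hddef, List.length_cons, pow_succ]; ring

/-! ### Nearest-point cells and Marcinkiewicz–Zygmund inequalities -/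

theorem exists_measurable_nearest (C : Finset (Fin q → ℝ)) (hC : C.Nonempty) :
    ∃ φ : (Fin q → ℝ) → (Fin q → ℝ), Measurable φ ∧ (∀ x, φ x ∈ C) ∧
      ∀ x, ∀ y ∈ C, dist x (φ x) ≤ dist x y := by
  induction hC using Finset.Nonempty.cons_induction with
  | singleton a => exact ⟨fun _ => a, measurable_const, by simp, by simp⟩
  | cons a C _ _ ih =>
    obtain ⟨φ, hm, hmem, hmin⟩ := ih
    classical
    refine ⟨fun x => if dist x (φ x) ≤ dist x a then φ x else a,
      Measurable.ite (measurableSet_le (measurable_id.dist hm) (measurable_id.dist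
        measurable_const)) hm measurable_const, fun x => ?_, fun x y hy => ?_⟩
    · dsimp only
      split_ifs
      · exact Finset.mem_cons_of_mem (hmem x)
      · exact Finset.mem_cons_self a C
    · dsimp only
      rw [Finset.mem_cons] at hy
      split_ifs with h
      · rcases hy with rfl | hy
        · exact h
        · exact hmin x y hy
      · rcases hy with rfl | hy
        · exact le_rfl
        · exact (not_le.1 h).le.trans (hmin x y hy)

theorem infDist_le_meshNorm (A n : ℝ) (C : Finset (Fin q → ℝ)) {x : Fin q → ℝ}
    (hx : x ∈ cube q A n) : Metric.infDist x (C : Set (Fin q → ℝ)) ≤ meshNorm A n C := by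
  refine le_csSup ?_ ⟨x, hx, rfl⟩
  exact (isCompact_Icc.image (Metric.continuous_infDist_pt _)).bddAbove

theorem meshNorm_nonneg (A n : ℝ) (C : Finset (Fin q → ℝ)) : 0 ≤ meshNorm A n C :=
  Real.sSup_nonneg (by rintro _ ⟨x, -, rfl⟩; exact Metric.infDist_nonneg)

theorem exists_measurable_dist_le_meshNorm (A n : ℝ) (C : Finset (Fin q → ℝ)) (hC : C.Nonempty) :
    ∃ φ : (Fin q → ℝ) → (Fin q → ℝ), Measurable φ ∧ (∀ x, φ x ∈ C) ∧
      ∀ x ∈ cube q A n, dist (φ x) x ≤ meshNorm A n C := by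
  obtain ⟨φ, hm, hmem, hmin⟩ := exists_measurable_nearest C hC
  refine ⟨φ, hm, hmem, fun x hx => ?_⟩
  rw [dist_comm]
  exact ((Metric.le_infDist (Finset.coe_nonempty.2 hC)).2 fun y hy => hmin x y hy).trans
    (infDist_le_meshNorm A n C hx)

theorem lintegral_compl_cube_le {A n : ℝ} (hA : 0 < A) (hn : 10 ≤ n)
    (P : MvPolynomial (Fin q) ℝ) (hP : ∀ i, P.degreeOf i ≤ 2 * n ^ 2) :
    ∫⁻ x in (cube q A n)ᶜ, ‖weighted A P x‖ₑ ≤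
      ENNReal.ofReal (q * (8100 / n)) * ∫⁻ x, ‖weighted A P x‖ₑ := by
  have hn0 : 0 < n := by linarith
  have hsub : (cube q A n)ᶜ ⊆ ⋃ i, {x : Fin q → ℝ | 3 * n / A < |x i|} := by
    intro x hx
    by_contra h
    apply hx
    simp only [Set.mem_iUnion, Set.mem_ofPred_eq, not_exists, not_lt] at h
    exact ⟨fun i => (abs_le.1 (h i)).1, fun i => (abs_le.1 (h i)).2⟩
  calc ∫⁻ x in (cube q A n)ᶜ, ‖weighted A P x‖ₑ
      ≤ ∫⁻ x in ⋃ i, {x : Fin q → ℝ | 3 * n / A < |x i|}, ‖weighted A P x‖ₑ :=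
        lintegral_mono_set hsub
    _ ≤ ∑' i : Fin q, ∫⁻ x in {x : Fin q → ℝ | 3 * n / A < |x i|}, ‖weighted A P x‖ₑ :=
        lintegral_iUnion_le _ _
    _ = ∑ i : Fin q, ∫⁻ x in {x : Fin q → ℝ | 3 * n / A < |x i|}, ‖weighted A P x‖ₑ :=
        tsum_fintype _
    _ ≤ ∑ _i : Fin q, ENNReal.ofReal (8100 / n) * ∫⁻ x, ‖weighted A P x‖ₑ :=
        Finset.sum_le_sum fun i _ => lintegral_weighted_tail_le hA hn P (hP i)
    _ = _ := by
        rw [Finset.sum_const, Finset.card_univ, Fintype.card_fin, nsmul_eq_mul, ← mul_assoc,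
          ENNReal.ofReal_mul (by positivity), ENNReal.ofReal_natCast]

theorem setLIntegral_comp_eq_sum {C : Finset (Fin q → ℝ)} {φ : (Fin q → ℝ) → (Fin q → ℝ)}
    (hφ : Measurable φ) (hmem : ∀ x, φ x ∈ C) (Q : Set (Fin q → ℝ)) (F : (Fin q → ℝ) → ENNReal) :
    ∫⁻ x in Q, F (φ x) = ∑ y ∈ C, F y * volume (φ ⁻¹' {y} ∩ Q) := by
  have hS : ∀ y, MeasurableSet (φ ⁻¹' {y}) := fun y => hφ (measurableSet_singleton y)
  have : ∀ x, F (φ x) = ∑ y ∈ C, (φ ⁻¹' {y}).indicator (fun _ => F y) x := by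
    intro x
    rw [Finset.sum_eq_single (φ x)]
    · simp
    · intro y _ hy
      simp [Set.indicator, hy.symm]
    · exact fun h => absurd (hmem x) h
  simp_rw [this]
  rw [lintegral_finsetSum _ fun y _ => measurable_const.indicator (hS y)]
  refine Finset.sum_congr rfl fun y _ => ?_
  rw [lintegral_indicator (hS y), setLIntegral_const, Measure.restrict_apply (hS y)]

/-- Marcinkiewicz-Zygmund inequalities with the volumes of nearest-point cells as weights. -/
theorem exists_cell_weights (hq : 1 ≤ q) {A n : ℝ} (hA : 0 < A) (hn : 32400 * q ≤ n)
    (C : Finset (Fin q → ℝ)) (hC : C.Nonempty)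
    (hmesh : meshNorm A n C ≤ 1 / (38400 * q) / (n * A)) :
    ∃ μ : (Fin q → ℝ) → ℝ, (∀ y, 0 ≤ μ y) ∧ (∀ y, μ y ≤ (2 * meshNorm A n C) ^ q) ∧
      ∑ y ∈ C, μ y ≤ (6 * n / A) ^ q ∧
      ∀ P : MvPolynomial (Fin q) ℝ, (∀ i, P.degreeOf i ≤ 2 * n ^ 2) →
        ∫ x, |weighted A P x| ≤ 2 * ∑ y ∈ C, μ y * |weighted A P y| ∧
        ∑ y ∈ C, μ y * |weighted A P y| ≤ 2 * ∫ x, |weighted A P x| := by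
  obtain ⟨φ, hφ, hmem, hdist⟩ := exists_measurable_dist_le_meshNorm A n C hC
  have hδ := meshNorm_nonneg A n C
  set δ := meshNorm A n C with hδdef
  have hq' : (1 : ℝ) ≤ q := by exact_mod_cast hq
  have hn1 : 16200 ≤ n := by linarith
  have hn0 : 0 < n := by linarith
  have hQ : MeasurableSet (cube q A n) := measurableSet_Icc
  have hQvol : volume (cube q A n) = ENNReal.ofReal ((6 * n / A) ^ q) := by
    rw [cube, Real.volume_Icc_pi, Finset.prod_const, Finset.card_univ, Fintype.card_fin,
      ← ENNReal.ofReal_pow (by rw [sub_neg_eq_add]; positivity)]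
    congr 2; ring
  have hcell : ∀ y, volume (φ ⁻¹' {y} ∩ cube q A n) ≤ ENNReal.ofReal ((2 * δ) ^ q) := by
    intro y
    have : φ ⁻¹' {y} ∩ cube q A n ⊆ Metric.closedBall y δ := by
      rintro x ⟨hx, hxQ⟩
      have hx' : φ x = y := hx
      rw [Metric.mem_closedBall, dist_comm, ← hx']
      exact hdist x hxQ
    refine (measure_mono this).trans ?_
    rw [Real.volume_pi_closedBall y hδ, Fintype.card_fin]
  have hfin : ∀ y, volume (φ ⁻¹' {y} ∩ cube q A n) ≠ ⊤ := fun y =>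
    ((hcell y).trans_lt ENNReal.ofReal_lt_top).ne
  refine ⟨fun y => (volume (φ ⁻¹' {y} ∩ cube q A n)).toReal, fun y => ENNReal.toReal_nonneg,
    fun y => ENNReal.toReal_le_of_le_ofReal (by positivity) (hcell y), ?_, fun P hP => ?_⟩
  · rw [← ENNReal.toReal_sum fun y _ => hfin y]
    refine ENNReal.toReal_le_of_le_ofReal (by positivity) ?_
    have h := setLIntegral_comp_eq_sum hφ hmem (cube q A n) fun _ => 1
    simp only [one_mul, setLIntegral_one] at h
    rw [← h, hQvol]
  have hint := integrable_weighted hA P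
  set N := ∫⁻ x, ‖weighted A P x‖ₑ with hN
  set S := ∫⁻ x in cube q A n, ‖weighted A P (φ x)‖ₑ with hS
  have hNreal : N = ENNReal.ofReal (∫ x, |weighted A P x|) :=
    (ofReal_integral_norm_eq_lintegral_enorm hint).symm
  have hSreal : S = ENNReal.ofReal (∑ y ∈ C,
      (volume (φ ⁻¹' {y} ∩ cube q A n)).toReal * |weighted A P y|) := by
    rw [hS, setLIntegral_comp_eq_sum hφ hmem (cube q A n) fun y => ‖weighted A P y‖ₑ,
      ENNReal.ofReal_sum_of_nonneg fun y _ => by positivity]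
    refine Finset.sum_congr rfl fun y _ => ?_
    rw [ENNReal.ofReal_mul ENNReal.toReal_nonneg, ENNReal.ofReal_toReal (hfin y), mul_comm,
      Real.enorm_eq_ofReal_abs]
  set L := localVar A δ (Finset.univ : Finset (Fin q)).toList P with hL
  have hLmeas : Measurable L := measurable_localVar _ _ _ _
  have hLint : ∫⁻ x, L x ≤ ENNReal.ofReal (1 / 4) * N := by
    refine (lintegral_localVar_le hA hn1 hδ _ (Finset.nodup_toList _) P fun i _ => hP i).trans ?_
    gcongr
    rw [Finset.length_toList, Finset.card_univ, Fintype.card_fin]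
    -- Here the mesh constant is spent: 4800/38400 = 1/8, and (1 + 1/(8q))^q - 1 ≤ exp(1/8) - 1 ≤
    -- 1/4 uniformly in q.
    have h1 : 2 * δ * (2400 * n * A) ≤ 1 / 8 / q := by
      have : δ * (n * A) ≤ 1 / (38400 * q) := (le_div_iff₀ (by positivity)).1 hmesh
      calc 2 * δ * (2400 * n * A) = 4800 * (δ * (n * A)) := by ring
        _ ≤ 4800 * (1 / (38400 * q)) := by gcongr
        _ = _ := by field_simp; norm_num
    have h2 : (1 + 2 * δ * (2400 * n * A)) ^ q ≤ Real.exp (1 / 8) := by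
      calc (1 + 2 * δ * (2400 * n * A)) ^ q ≤ (1 + 1 / 8 / q) ^ q := by gcongr
        _ ≤ Real.exp (1 / 8 / q) ^ q := by
            gcongr; linarith [Real.add_one_le_exp (1 / 8 / (q : ℝ))]
        _ = Real.exp (1 / 8) := by rw [← Real.exp_nat_mul]; congr 1; field_simp
    have h3 : Real.exp (1 / 8) ≤ 5 / 4 := by
      have := Real.exp_bound_div_one_sub_of_interval (x := 1 / 8) (by norm_num) (by norm_num)
      exact this.trans (by norm_num)
    linarith
  -- The q coordinate tails contribute at most 8100q/n, which is at most 1/4 once n ≥ 32400q.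
  have htail : ∫⁻ x in (cube q A n)ᶜ, ‖weighted A P x‖ₑ ≤ ENNReal.ofReal (1 / 4) * N := by
    refine (lintegral_compl_cube_le hA (by linarith) P hP).trans ?_
    gcongr
    rw [← mul_div_assoc, div_le_iff₀ hn0]
    linarith
  have hosc : ∀ x ∈ cube q A n, ‖weighted A P (φ x) - weighted A P x‖ₑ ≤ L x := by
    intro x hx
    refine enorm_weighted_sub_le_localVar A δ _ P (fun j _ => ?_) fun j hj => ?_
    · rw [← Real.dist_eq]
      exact (dist_le_pi_dist (φ x) x j).trans (hdist x hx)
    · simp at hj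
  have hWm : Measurable fun x => ‖weighted A P x‖ₑ := (continuous_weighted A P).measurable.enorm
  have hLQ : ∫⁻ x in cube q A n, L x ≤ ENNReal.ofReal (1 / 4) * N :=
    (setLIntegral_le_lintegral _ _).trans hLint
  have hup : S ≤ N + ENNReal.ofReal (1 / 4) * N := by
    calc S ≤ ∫⁻ x in cube q A n, (‖weighted A P x‖ₑ + L x) := by
          refine setLIntegral_mono' hQ fun x hx => ?_
          calc ‖weighted A P (φ x)‖ₑ
              = ‖weighted A P x + (weighted A P (φ x) - weighted A P x)‖ₑ := by
                rw [add_sub_cancel]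
            _ ≤ _ := (enorm_add_le _ _).trans (by gcongr; exact hosc x hx)
      _ = (∫⁻ x in cube q A n, ‖weighted A P x‖ₑ) + ∫⁻ x in cube q A n, L x :=
          lintegral_add_left hWm _
      _ ≤ _ := add_le_add (setLIntegral_le_lintegral _ _) hLQ
  -- One quarter is lost to oscillation and one to the tail; absorbing both gives N ≤ 2S.
  have hlow : N ≤ S + ENNReal.ofReal (1 / 4) * N + ENNReal.ofReal (1 / 4) * N := by
    calc N = (∫⁻ x in cube q A n, ‖weighted A P x‖ₑ) +
          ∫⁻ x in (cube q A n)ᶜ, ‖weighted A P x‖ₑ := (lintegral_add_compl _ hQ).symm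
      _ ≤ (∫⁻ x in cube q A n, (‖weighted A P (φ x)‖ₑ + L x)) + ENNReal.ofReal (1 / 4) * N := by
          refine add_le_add (setLIntegral_mono' hQ fun x hx => ?_) htail
          calc ‖weighted A P x‖ₑ
              = ‖weighted A P (φ x) + -(weighted A P (φ x) - weighted A P x)‖ₑ := by
                congr 1; ring
            _ ≤ _ := (enorm_add_le _ _).trans (by rw [enorm_neg]; gcongr; exact hosc x hx)
      _ = (S + ∫⁻ x in cube q A n, L x) + ENNReal.ofReal (1 / 4) * N := by
          rw [lintegral_add_right _ hLmeas]
      _ ≤ _ := by gcongr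
  set I := ∫ x, |weighted A P x| with hI
  have hI0 : 0 ≤ I := integral_nonneg fun x => abs_nonneg _
  set T := ∑ y ∈ C, (volume (φ ⁻¹' {y} ∩ cube q A n)).toReal * |weighted A P y| with hT
  have hT0 : 0 ≤ T := Finset.sum_nonneg fun y _ => by positivity
  rw [hNreal, hSreal, ← ENNReal.ofReal_mul (by norm_num), ← ENNReal.ofReal_add (by positivity)
    (by positivity), ENNReal.ofReal_le_ofReal_iff (by positivity)] at hup
  rw [hNreal, hSreal, ← ENNReal.ofReal_mul (by norm_num), ← ENNReal.ofReal_add (by positivity)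
    (by positivity), ← ENNReal.ofReal_add (by positivity)
    (by positivity), ENNReal.ofReal_le_ofReal_iff (by positivity)] at hlow
  constructor <;> linarith

/-! ### Duality and the quadrature weights -/

/-- Functionals bounded by a weighted `ℓ¹` norm of samples are combinations of the samples. -/
theorem exists_representing_weights {ι V : Type*} [Fintype ι] [AddCommGroup V] [Module ℝ V]
    (ev : V →ₗ[ℝ] (ι → ℝ)) (ℓ : V →ₗ[ℝ] ℝ) (m : ι → ℝ) (hm : ∀ i, 0 ≤ m i)
    (h : ∀ v, |ℓ v| ≤ ∑ i, m i * |ev v i|) :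
    ∃ w : ι → ℝ, (∀ i, |w i| ≤ m i) ∧ ∀ v, ℓ v = ∑ i, w i * ev v i := by
  classical
  -- The bound forces ℓ to vanish when all samples vanish, so ℓ descends to the range of `ev`, where
  -- Hahn–Banach applies.
  have hker : ℓ ∈ (LinearMap.ker ev).dualAnnihilator := by
    rw [Submodule.mem_dualAnnihilator]
    intro v hv
    have := h v
    rw [LinearMap.mem_ker.1 hv] at this
    simpa using this
  rw [← LinearMap.range_dualMap_eq_dualAnnihilator_ker] at hker
  obtain ⟨L, hL⟩ := hker
  have hL' : ∀ v, L (ev v) = ℓ v := fun v => by rw [← hL]; rfl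
  obtain ⟨g, hg, hgN⟩ := exists_extension_of_le_sublinear (L.toPMap (LinearMap.range ev))
    (fun a => ∑ i, m i * |a i|)
    (fun c hc x => by
      rw [Finset.mul_sum]
      refine Finset.sum_congr rfl fun i _ => ?_
      rw [Pi.smul_apply, smul_eq_mul, abs_mul, abs_of_pos hc]; ring)
    (fun x y => by
      rw [← Finset.sum_add_distrib]
      refine Finset.sum_le_sum fun i _ => ?_
      rw [← mul_add]
      exact mul_le_mul_of_nonneg_left (abs_add_le _ _) (hm i))
    (by
      rintro ⟨_, v, rfl⟩
      change L (ev v) ≤ ∑ i, m i * |ev v i|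
      rw [hL']
      exact (le_abs_self _).trans (h v))
  refine ⟨fun i => g (Pi.single i 1), fun i => ?_, fun v => ?_⟩
  · have hs : ∀ s : ℝ, |s| = 1 → ∑ j, m j * |(Pi.single i s : ι → ℝ) j| = m i := by
      intro s hs
      rw [Finset.sum_eq_single i]
      · simp [hs]
      · intro j _ hj; simp [hj]
      · simp
    rw [abs_le']
    constructor
    · exact (hgN _).trans (hs 1 (by simp)).le
    · have := (hgN (Pi.single i (-1))).trans (hs (-1) (by simp)).le
      rwa [Pi.single_neg, map_neg] at this
  · have h1 : g (ev v) = ℓ v := by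
      have := hg ⟨ev v, v, rfl⟩
      rw [← hL' v]
      exact this
    rw [← h1]
    conv_lhs => rw [pi_eq_sum_univ' (ev v), map_sum]
    refine Finset.sum_congr rfl fun i _ => ?_
    rw [map_smul, smul_eq_mul, mul_comm]

/-- The space of polynomials of degree less than `d` in each variable. -/
noncomputable def coordSubmodule (q : ℕ) {d : ℝ} (hd : 0 < d) :
    Submodule ℝ (MvPolynomial (Fin q) ℝ) where
  carrier := {P | ∀ i, (P.degreeOf i : ℝ) < d}
  zero_mem' := fun i => by simpa using hd
  add_mem' := fun {P Q} hP hQ i => by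
    have h : ((P + Q).degreeOf i : ℝ) ≤ max (P.degreeOf i : ℝ) (Q.degreeOf i) := by
      exact_mod_cast MvPolynomial.degreeOf_add_le i P Q
    exact h.trans_lt (max_lt (hP i) (hQ i))
  smul_mem' := fun c P hP i => by
    have h : ((c • P).degreeOf i : ℝ) ≤ P.degreeOf i := by
      rw [MvPolynomial.smul_eq_C_mul]
      exact_mod_cast MvPolynomial.degreeOf_C_mul_le P i c
    exact h.trans_lt (hP i)

theorem mul_mem_coordPoly {n : ℝ} {P Q : MvPolynomial (Fin q) ℝ} (hP : P ∈ totalPoly q n)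
    (hQ : Q ∈ totalPoly q n) : P * Q ∈ coordPoly q (√2 * n) := by
  intro i
  have h1 : (P.totalDegree : ℝ) < n ^ 2 := hP
  have h2 : (Q.totalDegree : ℝ) < n ^ 2 := hQ
  have h3 : (P * Q).degreeOf i ≤ P.totalDegree + Q.totalDegree :=
    (MvPolynomial.degreeOf_mul_le i P Q).trans (add_le_add
      (MvPolynomial.degreeOf_le_totalDegree P i) (MvPolynomial.degreeOf_le_totalDegree Q i))
  have h4 : ((P * Q).degreeOf i : ℝ) ≤ P.totalDegree + Q.totalDegree := by exact_mod_cast h3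
  rw [mul_pow, Real.sq_sqrt zero_le_two]
  linarith

theorem exists_quadrature_weights (hq : 1 ≤ q) {A n : ℝ} (hA : 0 < A) (hn : 32400 * q ≤ n)
    (C : Finset (Fin q → ℝ)) (hC : C.Nonempty)
    (hmesh : meshNorm A n C ≤ 1 / (38400 * q) / (n * A)) :
    ∃ w : (Fin q → ℝ) → ℝ,
      (∀ P ∈ coordPoly q (√2 * n), ExactFor A C w P) ∧
      (∀ y ∈ C, |w y| ≤ 2 * (2 * meshNorm A n C) ^ q) ∧
      ∑ y ∈ C, |w y| ≤ 2 * (6 * n / A) ^ q ∧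
      ∀ P ∈ coordPoly q (√2 * n),
        ∑ y ∈ C, |w y * MvPolynomial.eval y P| * gauss A y ≤
          4 * ∫ y, |MvPolynomial.eval y P| * gauss A y := by
  obtain ⟨μ, hμ0, hμ1, hμ2, hMZ⟩ := exists_cell_weights hq hA hn C hC hmesh
  have hq' : (1 : ℝ) ≤ q := by exact_mod_cast hq
  have hn0 : 0 < n := by linarith
  have hsq : (√2 * n) ^ 2 = 2 * n ^ 2 := by rw [mul_pow, Real.sq_sqrt zero_le_two]
  have hd : 0 < (√2 * n) ^ 2 := by positivity
  have hdeg : ∀ P ∈ coordPoly q (√2 * n), ∀ i, (P.degreeOf i : ℝ) ≤ 2 * n ^ 2 :=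
    fun P hP i => hsq ▸ (hP i).le
  let V := coordSubmodule q hd
  let ev : V →ₗ[ℝ] (C → ℝ) :=
    { toFun := fun P y => weighted A P.1 y
      map_add' := fun P Q => by funext y; simp [weighted, add_mul]
      map_smul' := fun c P => by funext y; simp [weighted, mul_assoc] }
  let ℓ : V →ₗ[ℝ] ℝ :=
    { toFun := fun P => ∫ x, weighted A P.1 x
      map_add' := fun P Q => by
        rw [← integral_add (integrable_weighted hA _) (integrable_weighted hA _)]
        simp [weighted, add_mul]
      map_smul' := fun c P => by
        rw [RingHom.id_apply, smul_eq_mul, ← integral_const_mul]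
        simp [weighted, mul_assoc] }
  -- The Gaussian factor is part of the samples in `ev`, so the weights obtained multiply P(y)
  -- exp(-A²|y|²), as required.
  obtain ⟨w, hw, hwℓ⟩ := exists_representing_weights ev ℓ (fun y => 2 * μ y)
    (fun y => by have := hμ0 y; positivity) (fun P => by
      have h1 := (hMZ P.1 (hdeg P.1 P.2)).1
      have h2 : |ℓ P| ≤ ∫ x, |weighted A P.1 x| := abs_integral_le_integral_abs
      refine h2.trans (h1.trans (le_of_eq ?_))
      rw [Finset.mul_sum, ← Finset.sum_coe_sort C]
      exact Finset.sum_congr rfl fun y _ => (mul_assoc _ _ _).symm)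
  classical
  let W : (Fin q → ℝ) → ℝ := fun y => if h : y ∈ C then w ⟨y, h⟩ else 0
  have hWC : ∀ y : C, W y = w y := fun y => by simp [W]
  have hW : ∀ y ∈ C, |W y| ≤ 2 * μ y := fun y hy => by rw [hWC ⟨y, hy⟩]; exact hw ⟨y, hy⟩
  refine ⟨W, fun P hP => ?_, fun y hy => ?_, ?_, fun P hP => ?_⟩
  · have h := hwℓ ⟨P, hP⟩
    change ∑ y ∈ C, W y * MvPolynomial.eval y P * gauss A y = ∫ x, weighted A P x
    refine Eq.trans ?_ h.symm
    rw [← Finset.sum_coe_sort C]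
    refine Finset.sum_congr rfl fun y _ => ?_
    rw [hWC, mul_assoc]
    rfl
  · refine (hW y hy).trans ?_
    gcongr
    exact hμ1 y
  · refine (Finset.sum_le_sum hW).trans ?_
    rw [← Finset.mul_sum]
    gcongr
  · have hg : ∀ y : Fin q → ℝ, 0 < gauss A y := fun y => Real.exp_pos _
    have habs : ∀ y, |weighted A P y| = |MvPolynomial.eval y P| * gauss A y := fun y => by
      rw [weighted, abs_mul, abs_of_pos (hg y)]
    have h2 := (hMZ P (hdeg P hP)).2
    simp only [habs] at h2
    calc ∑ y ∈ C, |W y * MvPolynomial.eval y P| * gauss A y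
        ≤ ∑ y ∈ C, 2 * (μ y * (|MvPolynomial.eval y P| * gauss A y)) := by
          refine Finset.sum_le_sum fun y hy => ?_
          rw [abs_mul, mul_assoc, ← mul_assoc 2]
          exact mul_le_mul_of_nonneg_right (hW y hy) (mul_nonneg (abs_nonneg _) (hg y).le)
      _ ≤ _ := by
          rw [← Finset.mul_sum]
          linarith

end GaussQuad

theorem theorem2p3 (q : ℕ) (hq : 1 ≤ q) :
    ∃ β : ℝ, 0 < β ∧ ∃ N : ℝ, 0 < N ∧ ∃ c : ℝ, 0 < c ∧
      ∀ A : ℝ, 0 < A → ∀ n : ℝ, N ≤ n →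
        ∀ C : Finset (Fin q → ℝ), C.Nonempty →
          (C : Set (Fin q → ℝ)) ⊆ GaussQuad.cube q A n →
          GaussQuad.meshNorm A n C ≤ β / (n * A) →
          ∃ w : (Fin q → ℝ) → ℝ,
            (∀ P ∈ GaussQuad.coordPoly q (Real.sqrt 2 * n), GaussQuad.ExactFor A C w P) ∧
            (∀ P ∈ GaussQuad.totalPoly q n, ∀ Q ∈ GaussQuad.totalPoly q n,
              GaussQuad.ExactFor A C w (P * Q)) ∧
            (∀ y ∈ C, |w y| ≤ c * GaussQuad.meshNorm A n C ^ q) ∧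
            ∑ y ∈ C, |w y| ≤ c * n ^ q / A ^ q ∧
            (∀ P ∈ GaussQuad.coordPoly q (Real.sqrt 2 * n),
              ∑ y ∈ C, |w y * MvPolynomial.eval y P| * GaussQuad.gauss A y ≤
                c * ∫ y, |MvPolynomial.eval y P| * GaussQuad.gauss A y) := by
  have hq' : (1 : ℝ) ≤ q := by exact_mod_cast hq
  -- One constant c dominates the three that occur: 2 · 2^q, 2 · 6^q and 4.
  refine ⟨1 / (38400 * q), by positivity, 32400 * q, by positivity, 2 * 6 ^ q + 4, by positivity,
    fun A hA n hn C hC _ hmesh => ?_⟩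
  obtain ⟨w, h1, h2, h3, h4⟩ := GaussQuad.exists_quadrature_weights hq hA hn C hC hmesh
  have hn0 : 0 < n := by linarith
  have hδ := GaussQuad.meshNorm_nonneg A n C
  refine ⟨w, h1, fun P hP Q hQ => h1 _ (GaussQuad.mul_mem_coordPoly hP hQ),
    fun y hy => (h2 y hy).trans ?_, h3.trans ?_, fun P hP => (h4 P hP).trans ?_⟩
  · rw [mul_pow, ← mul_assoc]
    have : (2 : ℝ) ^ q ≤ 6 ^ q := by gcongr; norm_num
    gcongr
    linarith
  · rw [div_pow, mul_pow, ← mul_div_assoc, ← mul_assoc]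
    gcongr
    linarith
  · have h0 : 0 ≤ ∫ y, |MvPolynomial.eval y P| * GaussQuad.gauss A y :=
      MeasureTheory.integral_nonneg fun y => mul_nonneg (abs_nonneg _) (Real.exp_pos _).le
    gcongr
    linarith [pow_pos (by norm_num : (0 : ℝ) < 6) q]
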